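/- Let $d\in\mathbb N$, $s>0$, $\lambda>0$. For a random variable $X$ with values in a measurable space $E$, a distortion $\rho:E\times E\to[0,\infty)$, $r\in\mathbb R$ and $\varepsilon>0$ put $$D^{(q)}(r\,|\,X,\rho,s)=\inf\Big\{\big(\mathbb E\min_{a\in\mathcal C}\rho(X,a)^s\big)^{1/s}:\ \emptyset\neq\mathcal C\subseteq E\text{ finite},\ \log\#\mathcal C\le r\Big\},$$ $$D^{(e)}(r\,|\,X,\rho,s)=\inf\Big\{\big(\mathbb E\rho(X,\hat X)^s\big)^{1/s}:\ \hat X\ \text{an $E$-valued random variable with } H(\hat X)\le r\Big\},$$ $$d^{(q)}(\varepsilon\,|\,X,\rho,s)=\inf\{n\ge 1:\ D^{(q)}(\log n\,|\,X,\rho,s)\le\varepsilon\}\in\mathbb N\cup\{\infty\},$$ where $\hat X$ is defined on the same probability space as $X$, and $H(\hat X)=-\sum_x\mathbb P(\hat X=x)\log\mathbb P(\hat X=x)$ if $\hat X$ is discrete and $H(\hat X)=\infty$ otherwise. Let $(e_j)_{j\ge1}$ be i.i.d. standard exponential random variables, let $N(t)=\max\{n\ge 0:\sum_{j=1}^n e_j\le\lambda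 t\}$ be the Poisson process of intensity $\lambda$ built from them, and let $(Z^{(i)})_{i\ge1}$ be i.i.d. $\mathbb R^d$-valued random variables, independent of $(e_j)$, with $\mathbb P(Z^{(1)}=0)=0$. Let $X(t)=\sum_{i=1}^{N(t)}Z^{(i)}$, $t\in[0,1)$, be the associated compound Poisson process, viewed as a random element of the space $\mathbf D$ of right-continuous, piecewise constant functions $f:[0,1)\to\mathbb R^d$ with finitely many jumps, endowed with the $\sigma$-field generated by the coordinate projections. On $\mathbb R^d$ use the distortion $\|x-y\|_\infty$, and on $\mathbf D$ the distortion $\rho_{\mathbf D}(f,g)=\int_0^1\|f(t)-g(t)\|_\infty\,dt$. Write $d^{(q)}(\varepsilon\,|\,Z^{(1)})=d^{(q)}(\varepsilon\,|\,Z^{(1)},\|\cdot\|_\infty,s)$. (a) If $\displaystyle\gamma:=\limsup_{\varepsilon\downarrow0}\frac{\log d^{(q)}(\varepsilon\,|\,Z^{(1)})}{\log(1/\varepsilon)}$ is finite, then $$\liminf_{r\to\infty}\ \frac{-\log D^{(q)}(r\,|\,X,\rho_{\mathbf D},s)}{\sqrt{\frac{2}{s(1+\gamma)}\,r\log r}}\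 \ge\ 1 .$$ (b) If $d^{(q)}(\varepsilon\,|\,Z^{(1)})<\infty$ for all $\varepsilon>0$, then there are a number $r_0$ depending only on $\lambda$ and a constant $C>0$ depending only on $s$, $\lambda$ and $\mathbb E\|Z^{(1)}\|_\infty^s$ such that for all $r\ge r_0$ $$D^{(e)}\big(\lambda r+(\lambda+1)\log d^{(q)}(e^{-r}\,|\,Z^{(1)})\,\big|\,X,\rho_{\mathbf D},s\big)\ \le\ C\,e^{-r}.$$ -/

import Mathlib

open MeasureTheory ProbabilityTheory Filter Topology
open scoped ENNReal

noncomputable section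

/-- The quantization error `D^(q)(r | X, ρ, s)`: the infimum of `(E min_{a ∈ C} ρ(X, a)^s)^(1/s)`
over all finite codebooks `C` with `log #C ≤ r`. -/
def quantError {Ω E : Type*} [MeasurableSpace Ω] (P : Measure Ω) (X : Ω → E)
    (ρ : E → E → ℝ≥0∞) (s r : ℝ) : ℝ≥0∞ :=
  ⨅ (C : Finset E) (_ : C.Nonempty ∧ Real.log (C.card : ℝ) ≤ r),
    (∫⁻ ω, (⨅ a ∈ C, ρ (X ω) a) ^ s ∂P) ^ (1 / s)

/-- The inverse `d^(q)(ε | X, ρ, s)` of the quantization error: the least `n ≥ 1` such that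
`D^(q)(log n | X, ρ, s) ≤ ε`, and `⊤` if there is none. -/
def quantNumber {Ω E : Type*} [MeasurableSpace Ω] (P : Measure Ω) (X : Ω → E)
    (ρ : E → E → ℝ≥0∞) (s ε : ℝ) : ℕ∞ :=
  ⨅ (n : ℕ) (_ : 1 ≤ n ∧ quantError P X ρ s (Real.log (n : ℝ)) ≤ ENNReal.ofReal ε), (n : ℕ∞)

open Classical in
/-- The entropy (in nats) of a random variable: `-∑ₓ P(Y = x) log P(Y = x)` if `Y` is discrete,
i.e. almost surely in a countable set, and `∞` otherwise. -/
def discreteEntropy {Ω E : Type*} [MeasurableSpace Ω] (P : Measure Ω) (Y : Ω → E) : ℝ≥0∞ :=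
  if ∃ S : Set E, S.Countable ∧ ∀ᵐ ω ∂P, Y ω ∈ S then
    ∑' x : E, ENNReal.ofReal (Real.negMulLog (P.real (Y ⁻¹' {x})))
  else ⊤

/-- The entropy coding error `D^(e)(r | X, ρ, s)`: the infimum of `(E ρ(X, X̂)^s)^(1/s)` over all
random variables `X̂` with entropy at most `r`. -/
def entropyError {Ω E : Type*} [MeasurableSpace Ω] [MeasurableSpace E] (P : Measure Ω)
    (X : Ω → E) (ρ : E → E → ℝ≥0∞) (s r : ℝ) : ℝ≥0∞ :=
  ⨅ (Y : Ω → E) (_ : Measurable Y ∧ ((discreteEntropy P Y : ℝ≥0∞) : EReal) ≤ (r : EReal)),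
    (∫⁻ ω, (ρ (X ω) (Y ω)) ^ s ∂P) ^ (1 / s)

/-- Right-continuous piecewise constant functions on `[0,1[` with finitely many jumps: there is a
finite set `T` such that `f` is constant on `[u,t]` whenever `T` has no point in `]u,t]`. -/
def IsJumpPath {E : Type*} (f : Set.Ico (0 : ℝ) 1 → E) : Prop :=
  ∃ T : Finset (Set.Ico (0 : ℝ) 1), ∀ u t : Set.Ico (0 : ℝ) 1, u ≤ t →
    (∀ x ∈ T, x ≤ u ∨ t < x) → f u = f t

/-- The space `D([0,1[, E)`. Its measurable structure, inherited from the product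
`[0,1[ → E`, is the one generated by the coordinate projections. -/
abbrev JumpPath (E : Type*) : Type _ := {f : Set.Ico (0 : ℝ) 1 → E // IsJumpPath f}

/-- The distortion `ρ_D(f, g) = ∫₀¹ ρ(f(t), g(t)) dt` on `D([0,1[, E)`. -/
def pathDistortion {E : Type*} (ρ : E → E → ℝ≥0∞) (f g : JumpPath E) : ℝ≥0∞ :=
  ∫⁻ t : Set.Ico (0 : ℝ) 1, ρ (f.1 t) (g.1 t) ∂(Measure.comap Subtype.val volume)

/-- The distortion `‖x - y‖_∞ = max_i |x_i - y_i|` on `ℝ^d`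
(the norm of `Fin d → ℝ` is the sup norm). -/
def supDist (d : ℕ) (x y : Fin d → ℝ) : ℝ≥0∞ := ENNReal.ofReal ‖x - y‖

/-- The counting function `N(t) = max {n ≥ 0 : e₁ + ⋯ + eₙ ≤ lam * t}`. -/
def countJumps (lam : ℝ) (e : ℕ → ℝ) (t : ℝ) : ℕ :=
  sSup {n : ℕ | ∑ j ∈ Finset.range n, e j ≤ lam * t}

/-- `X` is the compound Poisson process `X(t) = ∑_{i ≤ N(t)} Z^(i)`, `t ∈ [0,1[`, in `ℝ^d` of
intensity `lam > 0` built from i.i.d. standard exponential variables `e` and, independently of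
them, i.i.d. increments `Z` that are almost surely nonzero. The sequences are indexed from `0`, so
that `Z 0` is `Z^(1)`. -/
structure IsCompoundPoisson {Ω : Type*} [MeasurableSpace Ω] (P : Measure Ω) {d : ℕ} (lam : ℝ)
    (e : ℕ → Ω → ℝ) (Z : ℕ → Ω → (Fin d → ℝ)) (X : Ω → JumpPath (Fin d → ℝ)) : Prop where
  lam_pos : 0 < lam
  measurable_e : ∀ j, Measurable (e j)
  law_e : ∀ j, P.map (e j) = expMeasure 1
  indep_e : iIndepFun e P
  measurable_Z : ∀ i, Measurable (Z i)
  identDistrib_Z : ∀ i, IdentDistrib (Z i) (Z 0) P P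
  indep_Z : iIndepFun Z P
  indep_e_Z : IndepFun (fun ω j => e j ω) (fun ω i => Z i ω) P
  Z_ne_zero : P {ω | Z 0 ω = 0} = 0
  measurable_X : Measurable X
  X_eq : ∀ᵐ ω ∂P, ∀ t : Set.Ico (0 : ℝ) 1,
    (X ω).1 t = ∑ i ∈ Finset.range (countJumps lam (fun j => e j ω) t), Z i ω

end

/-! ### Partial sums of independent exponential variables -/

/-! Both parts code a path by its number of jumps `n`, by each jump time rounded to a grid of mesh
`1/K`, and by each increment replaced by a nearest point of a finite codebook `C`. The distortion is
additive over jumps: jump `i` costs at most `‖Z i‖ / K` plus the distance of `Z i` to `C`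
(`pathDistortion_stepPath_le`, `ae_pathDistortion_le`). On the event of `n` jumps, independence of
jump times and increments, the bound `λ^n / n!` for the probability of that event, and the crude
inequality `(∑ yᵢ)^s ≤ n^s ∑ yᵢ^s` bound the `s`-th moment by `λ^n / n! * exp ((s+1) n)` times the
moment of one letter error. The factorial makes these weights summable, even after multiplication by
another `exp (a n)`.

For (b), `K` and `C` do not depend on `n`. Gibbs' inequality against a geometric law for `n` and
uniform letters bounds the entropy by `log 2 + E N (log 2 + log (K #C))`, and `E N ≤ λ`. Taking `K`
of order `exp r` and `C` of precision about `exp (-r)` gives the claim.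

For (a), many jumps are unlikely, so they may be coded coarsely. With `n` jumps the letter precision
is `exp (-l n)`, where `l n = max (R - a n / s) 0`. The error is then at most `exp (-sR)` times `∑
(λ exp (s+1+a))^n / n!`, up to a constant, while the `n`-th codebook has logarithmic size about
`(1+g) n l n ≤ (1+g) s R² / (4a)`, for any `g > γ`. The choice `a = θ log R` with `θ < 1` makes the
sum `exp (O (R^θ))`, negligible against `exp (sR)`. Solving `(1+g) s R² / (4 θ log R) ≈ r` gives `R`
of order `√(2 r log r / (s (1+γ)))` up to powers of `θ`, and `θ` tends to `1` at the end
(`quantError_le_of_codebooks`, `eventually_quantError_le`). -/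

theorem lintegral_expMeasure_comp_sub_le {g : ℝ → ℝ≥0∞} (hg : Measurable g) {φ H : ℝ → ℝ} {x : ℝ}
    (hneg : ∀ y < 0, g y = 0)
    (hle : ∀ u, 0 < u → u ≤ x → ENNReal.ofReal (Real.exp (-u)) * g (x - u) ≤ ENNReal.ofReal (φ u))
    (hH : ∀ u ∈ Set.Icc 0 x, HasDerivAt H (φ u) u) (hc : Continuous φ)
    (hnn : ∀ u, 0 < u → u ≤ x → 0 ≤ φ u) (hx : 0 ≤ x) :
    ∫⁻ u, g (x - u) ∂(expMeasure 1) ≤ ENNReal.ofReal (H x - H 0) := by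
  have h1 : ∫⁻ u, g (x - u) ∂(expMeasure 1) = ∫⁻ u, exponentialPDF 1 u * g (x - u) := by
    unfold expMeasure gammaMeasure
    rw [lintegral_withDensity_eq_lintegral_mul]
    · rfl
    · exact (measurable_gammaPDFReal 1 1).ennreal_ofReal
    · fun_prop
  -- The bound by `φ` is only assumed for `u > 0`; the null point `0` is paid for with the value
  -- `⊤`.
  have h2 : ∀ u, exponentialPDF 1 u * g (x - u) ≤
      (Set.Ioc 0 x).indicator (fun u => ENNReal.ofReal (φ u)) u
        + ({0} : Set ℝ).indicator (fun _ => ⊤) u := by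
    intro u
    rcases lt_trichotomy u 0 with hu | hu | hu
    · simp [exponentialPDF_of_neg hu]
    · simp [hu]
    rcases lt_or_ge x u with hxu | hxu
    · simp [hneg (x - u) (by linarith)]
    · rw [Set.indicator_of_mem (show u ∈ Set.Ioc 0 x from ⟨hu, hxu⟩), exponentialPDF_of_nonneg hu.le]
      simpa using le_add_right (hle u hu hxu)
  calc ∫⁻ u, g (x - u) ∂(expMeasure 1)
      ≤ ∫⁻ u, ((Set.Ioc 0 x).indicator (fun u => ENNReal.ofReal (φ u)) u
        + ({0} : Set ℝ).indicator (fun _ => ⊤) u) := h1 ▸ lintegral_mono h2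
    _ = ∫⁻ u in Set.Ioc 0 x, ENNReal.ofReal (φ u) := by
        rw [lintegral_add_right _ (measurable_const.indicator (measurableSet_singleton 0)),
          lintegral_indicator measurableSet_Ioc, lintegral_indicator (measurableSet_singleton 0)]
        simp
    _ = ENNReal.ofReal (∫ u in Set.Ioc 0 x, φ u) := by
        rw [ofReal_integral_eq_lintegral_ofReal]
        · exact (hc.integrableOn_Icc).mono_set Set.Ioc_subset_Icc_self
        · exact (ae_restrict_iff' measurableSet_Ioc).2
            (Eventually.of_forall fun u hu => hnn _ hu.1 hu.2)
    _ = ENNReal.ofReal (H x - H 0) := by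
        rw [← intervalIntegral.integral_of_le hx,
          intervalIntegral.integral_eq_sub_of_hasDerivAt]
        · intro u hu
          rw [Set.uIcc_of_le hx] at hu
          exact hH u hu
        · exact hc.intervalIntegrable _ _

theorem lintegral_expMeasure_comp_sub_of_neg {g : ℝ → ℝ≥0∞} (hg : Measurable g) {x : ℝ}
    (hneg : ∀ y < 0, g y = 0) (hx : x < 0) : ∫⁻ u, g (x - u) ∂(expMeasure 1) = 0 := by
  unfold expMeasure gammaMeasure
  rw [lintegral_withDensity_eq_lintegral_mul]
  · rw [← lintegral_zero (α := ℝ) (μ := volume)]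
    congr 1
    ext u
    simp only [Pi.mul_apply]
    rcases lt_or_ge u 0 with hu | hu
    · simp [gammaPDF_of_neg hu]
    · simp [hneg (x - u) (by linarith)]
  · exact (measurable_gammaPDFReal 1 1).ennreal_ofReal
  · fun_prop

section
variable {Ω : Type*} [MeasurableSpace Ω] {P : Measure Ω} {e : ℕ → Ω → ℝ}

theorem measurable_measure_le (P : Measure Ω) [IsFiniteMeasure P] {S : Ω → ℝ} :
    Measurable fun x : ℝ => P {ω | S ω ≤ x} := by
  refine Monotone.measurable fun x y hxy => measure_mono fun ω (h : S ω ≤ x) => ?_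
  exact le_trans h hxy

theorem measure_sum_succ_le [IsProbabilityMeasure P] (hm : ∀ j, Measurable (e j))
    (hlaw : ∀ j, P.map (e j) = expMeasure 1) (hind : iIndepFun e P) (n : ℕ) (x : ℝ) :
    P {ω | ∑ j ∈ Finset.range (n + 1), e j ω ≤ x} =
      ∫⁻ u, P {ω | ∑ j ∈ Finset.range n, e j ω ≤ x - u} ∂(expMeasure 1) := by
  have hS : Measurable (∑ j ∈ Finset.range n, e j) := by fun_prop
  have hi : (∑ j ∈ Finset.range n, e j) ⟂ᵢ[P] e n :=
    hind.indepFun_finsetSum_of_notMem hm (by simp)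
  have hprod := (indepFun_iff_map_prod_eq_prod_map_map hS.aemeasurable (hm n).aemeasurable).1 hi
  have hset : MeasurableSet {p : ℝ × ℝ | p.1 + p.2 ≤ x} :=
    measurableSet_le (by fun_prop) measurable_const
  have h1 : P {ω | ∑ j ∈ Finset.range (n + 1), e j ω ≤ x} =
      P.map (fun ω => ((∑ j ∈ Finset.range n, e j) ω, e n ω)) {p : ℝ × ℝ | p.1 + p.2 ≤ x} := by
    rw [Measure.map_apply (hS.prodMk (hm n)) hset]
    simp [Finset.sum_range_succ]
  have : IsProbabilityMeasure (P.map (e n)) := Measure.isProbabilityMeasure_map (hm n).aemeasurable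
  rw [h1, hprod, Measure.prod_apply_symm hset, hlaw n]
  refine lintegral_congr fun u => ?_
  rw [Measure.map_apply hS (measurable_prodMk_right hset)]
  congr 1
  ext ω
  simp [le_sub_iff_add_le]

theorem measure_sum_le_of_neg [IsProbabilityMeasure P] (hm : ∀ j, Measurable (e j))
    (hlaw : ∀ j, P.map (e j) = expMeasure 1) (hind : iIndepFun e P) (n : ℕ) {x : ℝ} (hx : x < 0) :
    P {ω | ∑ j ∈ Finset.range n, e j ω ≤ x} = 0 := by
  induction n generalizing x with
  | zero => simp [not_le.2 hx]
  | succ n ih =>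
    rw [measure_sum_succ_le hm hlaw hind]
    exact lintegral_expMeasure_comp_sub_of_neg
      (g := fun y => P {ω | ∑ j ∈ Finset.range n, e j ω ≤ y}) (measurable_measure_le P)
      (fun y hy => ih hy) hx

/-- Discarding the factor `exp (-u)` in the convolution leaves the volume of a simplex. The Poisson
weight without `exp (-λ)` suffices, because only the factorial matters later. -/
theorem measure_sum_le_pow_div_factorial [IsProbabilityMeasure P] (hm : ∀ j, Measurable (e j))
    (hlaw : ∀ j, P.map (e j) = expMeasure 1) (hind : iIndepFun e P) (n : ℕ) {x : ℝ} (hx : 0 ≤ x) :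
    P {ω | ∑ j ∈ Finset.range n, e j ω ≤ x} ≤ ENNReal.ofReal (x ^ n / n.factorial) := by
  induction n generalizing x with
  | zero => simpa using prob_le_one
  | succ n ih =>
    rw [measure_sum_succ_le hm hlaw hind]
    have hd : ∀ u ∈ Set.Icc 0 x, HasDerivAt (fun u => -((x - u) ^ (n + 1) / (n + 1).factorial))
        ((x - u) ^ n / n.factorial) u := by
      intro u _
      refine ((((hasDerivAt_id u).const_sub x).pow (n + 1)).div_const
        ((n + 1).factorial : ℝ)).neg.congr_deriv ?_
      rw [Nat.factorial_succ]
      push_cast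
      field_simp
      simp
    refine (lintegral_expMeasure_comp_sub_le
      (g := fun y => P {ω | ∑ j ∈ Finset.range n, e j ω ≤ y}) (measurable_measure_le P)
      (fun y hy => measure_sum_le_of_neg hm hlaw hind n hy) (fun u hu hux => ?_) hd
      (by fun_prop) (fun u _ hu => ?_) hx).trans_eq (by simp)
    · refine (mul_le_of_le_one_left' ?_).trans (ih (by linarith))
      simpa using hu.le
    · have : 0 ≤ x - u := by linarith
      positivity

/-- The renewal function of the Poisson process, with the sharp constant, since `E N ≤ λ` yields the
coefficient of `r` in (b). Conditioning on one variable bounds the sum by `∫₀ˣ exp (-u) (1 + (x -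
u)) du`, which equals `x`. -/
theorem sum_measure_sum_le [IsProbabilityMeasure P] (hm : ∀ j, Measurable (e j))
    (hlaw : ∀ j, P.map (e j) = expMeasure 1) (hind : iIndepFun e P) (n : ℕ) {x : ℝ} (hx : 0 ≤ x) :
    ∑ k ∈ Finset.range n, P {ω | ∑ j ∈ Finset.range (k + 1), e j ω ≤ x} ≤ ENNReal.ofReal x := by
  induction n generalizing x with
  | zero => simp
  | succ n ih =>
    simp_rw [measure_sum_succ_le hm hlaw hind]
    have hms : ∀ k ∈ Finset.range (n + 1), Measurable
        fun u => P {ω | ∑ j ∈ Finset.range k, e j ω ≤ x - u} := fun k _ =>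
      (measurable_measure_le P (S := fun ω => ∑ j ∈ Finset.range k, e j ω)).comp
        (measurable_const.sub measurable_id)
    rw [← lintegral_finsetSum _ hms]
    have hd : ∀ u ∈ Set.Icc 0 x, HasDerivAt (fun u => Real.exp (-u) * (u - x))
        (Real.exp (-u) * (1 + (x - u))) u := by
      intro u _
      have h1 : HasDerivAt (fun u : ℝ => Real.exp (-u)) (Real.exp (-u) * -1) u :=
        ((hasDerivAt_id u).neg).exp
      refine (h1.mul ((hasDerivAt_id u).sub_const x)).congr_deriv ?_
      simp only [id]
      ring
    have := lintegral_expMeasure_comp_sub_le (x := x)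
      (g := fun y => ∑ k ∈ Finset.range (n + 1), P {ω | ∑ j ∈ Finset.range k, e j ω ≤ y})
      (Finset.measurable_sum _ fun k _ => measurable_measure_le P)
      (fun y hy => Finset.sum_eq_zero fun k _ => measure_sum_le_of_neg hm hlaw hind k hy)
      (fun u _ hux => ?_) hd (by fun_prop) (fun u _ hux => ?_) hx
    · simpa using this
    · rw [ENNReal.ofReal_mul (Real.exp_pos _).le]
      gcongr
      rw [Finset.sum_range_succ', add_comm, ENNReal.ofReal_add zero_le_one (by linarith)]
      gcongr
      · simpa using prob_le_one
      · exact ih (by linarith)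
    · have : 0 ≤ x - u := by linarith
      positivity

end

/-! ### The counting function -/

/-- `sSup` on `ℕ` takes the value `0` on empty and on unbounded sets, so a nonzero value must be a
true maximum. -/
theorem countJumps_eq_iff_of_ne_zero {lam t : ℝ} {y : ℕ → ℝ} {n : ℕ} (hn : n ≠ 0) :
    countJumps lam y t = n ↔ ∑ j ∈ Finset.range n, y j ≤ lam * t ∧
      ∀ k, n < k → lam * t < ∑ j ∈ Finset.range k, y j := by
  constructor
  · rintro h
    have hb : BddAbove {n : ℕ | ∑ j ∈ Finset.range n, y j ≤ lam * t} := by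
      by_contra hb
      exact hn (by rw [← h, countJumps, Nat.sSup_of_not_bddAbove hb])
    have hne : {n : ℕ | ∑ j ∈ Finset.range n, y j ≤ lam * t}.Nonempty := by
      by_contra hne
      exact hn (by rw [← h, countJumps, Set.not_nonempty_iff_eq_empty.1 hne, csSup_empty]; rfl)
    refine ⟨?_, fun k hk => ?_⟩
    · rw [← h]
      exact Nat.sSup_mem hne hb
    · by_contra! hle
      exact absurd (le_csSup hb hle) (by rw [← h] at hk; exact not_le.2 hk)
  · rintro ⟨h1, h2⟩
    refine IsGreatest.csSup_eq ⟨h1, fun k hk => ?_⟩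
    by_contra! hlt
    exact absurd (h2 k hlt) (not_lt.2 hk)

theorem measurable_countJumps (lam t : ℝ) : Measurable fun y : ℕ → ℝ => countJumps lam y t := by
  have h : ∀ n ≠ 0, MeasurableSet ((fun y : ℕ → ℝ => countJumps lam y t) ⁻¹' {n}) := by
    intro n hn
    have : (fun y : ℕ → ℝ => countJumps lam y t) ⁻¹' {n} =
        {y | ∑ j ∈ Finset.range n, y j ≤ lam * t} ∩
          ⋂ k, ⋂ (_ : n < k), {y | lam * t < ∑ j ∈ Finset.range k, y j} := by
      ext y
      simp [countJumps_eq_iff_of_ne_zero hn]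
    rw [this]
    refine (measurableSet_le (by fun_prop) measurable_const).inter ?_
    exact MeasurableSet.iInter fun k => MeasurableSet.iInter fun _ =>
      measurableSet_lt measurable_const (by fun_prop)
  refine measurable_to_countable' fun n => ?_
  -- The fibre over `0` also collects the default values of `sSup`, hence is treated as the
  -- complement of the other fibres.
  by_cases hn : n = 0
  · have : (fun y : ℕ → ℝ => countJumps lam y t) ⁻¹' {n} =
        (⋃ k, ⋃ (_ : k ≠ 0), (fun y : ℕ → ℝ => countJumps lam y t) ⁻¹' {k})ᶜ := by
      ext y
      simp only [hn, Set.mem_preimage, Set.mem_singleton_iff, Set.mem_compl_iff, Set.mem_iUnion,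
        not_exists]
      exact ⟨fun h0 k hk hk' => hk (hk'.symm.trans h0), fun h0 => by_contra fun h1 => h0 _ h1 rfl⟩
    rw [this]
    exact (MeasurableSet.iUnion fun k => MeasurableSet.iUnion fun hk => h k hk).compl
  · exact h n hn

theorem le_countJumps_iff {lam t : ℝ} {y : ℕ → ℝ} (hy : ∀ j, 0 ≤ y j)
    (hex : ∃ n, lam * t < ∑ j ∈ Finset.range n, y j) (ht : 0 ≤ lam * t) (i : ℕ) :
    i ≤ countJumps lam y t ↔ ∑ j ∈ Finset.range i, y j ≤ lam * t := by
  have hmono : Monotone fun n => ∑ j ∈ Finset.range n, y j := fun m n hmn =>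
    Finset.sum_le_sum_of_subset_of_nonneg (Finset.range_mono hmn) fun j _ _ => hy j
  have hb : BddAbove {n : ℕ | ∑ j ∈ Finset.range n, y j ≤ lam * t} := by
    obtain ⟨n, hn⟩ := hex
    refine ⟨n, fun k hk => ?_⟩
    by_contra! hlt
    exact absurd (hn.trans_le (hmono hlt.le)) (not_lt.2 hk)
  have hne : {n : ℕ | ∑ j ∈ Finset.range n, y j ≤ lam * t}.Nonempty := ⟨0, by simpa using ht⟩
  constructor
  · intro hi
    exact (hmono hi).trans (Nat.sSup_mem hne hb)
  · exact fun hi => le_csSup hb hi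

theorem sum_range_countJumps {E : Type*} [AddCommMonoid E] {lam t : ℝ} {y : ℕ → ℝ}
    (hlam : 0 ≤ lam) (hy : ∀ j, 0 ≤ y j) (hex : ∃ n, lam < ∑ j ∈ Finset.range n, y j)
    (ht : 0 ≤ t) (ht1 : t ≤ 1) (z : ℕ → E) :
    ∑ i ∈ Finset.range (countJumps lam y t), z i =
      ∑ i ∈ Finset.range (countJumps lam y 1),
        if ∑ j ∈ Finset.range (i + 1), y j ≤ lam * t then z i else 0 := by
  have hle : lam * t ≤ lam := mul_le_of_le_one_right hlam ht1
  have hex' : ∃ n, lam * t < ∑ j ∈ Finset.range n, y j := hex.imp fun n hn => hle.trans_lt hn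
  have h0 : 0 ≤ lam * t := mul_nonneg hlam ht
  rw [← Finset.sum_filter]
  refine Finset.sum_congr ?_ fun _ _ => rfl
  ext i
  simp only [Finset.mem_range, Finset.mem_filter, ← Nat.succ_le_iff]
  rw [le_countJumps_iff hy hex' h0, le_countJumps_iff hy (by simpa using hex) (by simpa using hlam)]
  simp only [Nat.succ_eq_add_one, mul_one]
  exact ⟨fun h => ⟨h.trans hle, h⟩, fun h => h.2⟩

section
variable {Ω : Type*} [MeasurableSpace Ω] {P : Measure Ω} {e : ℕ → Ω → ℝ}

theorem ae_nonneg_of_exp (hm : ∀ j, Measurable (e j)) (hlaw : ∀ j, P.map (e j) = expMeasure 1) :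
    ∀ᵐ ω ∂P, ∀ j, 0 ≤ e j ω := by
  refine ae_all_iff.2 fun j => ?_
  have h : ∀ᵐ x ∂(P.map (e j)), (0 : ℝ) ≤ x := by
    rw [hlaw j, ae_iff]
    have : {a : ℝ | ¬ 0 ≤ a} = Set.Iio 0 := by ext; simp
    rw [this, expMeasure, gammaMeasure, withDensity_apply _ measurableSet_Iio]
    exact lintegral_gammaPDF_of_nonpos le_rfl
  exact ae_of_ae_map (hm j).aemeasurable h

theorem ae_exists_lt_sum_of_exp [IsProbabilityMeasure P] (hm : ∀ j, Measurable (e j))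
    (hlaw : ∀ j, P.map (e j) = expMeasure 1) (hind : iIndepFun e P) {x : ℝ} (hx : 0 ≤ x) :
    ∀ᵐ ω ∂P, ∃ n, x < ∑ j ∈ Finset.range n, e j ω := by
  rw [ae_iff]
  have hlim : Tendsto (fun n : ℕ => ENNReal.ofReal (x ^ n / n.factorial)) atTop (𝓝 0) := by
    simpa using ENNReal.tendsto_ofReal (FloorSemiring.tendsto_pow_div_factorial_atTop x)
  refine le_antisymm (ge_of_tendsto' hlim fun n => ?_) zero_le
  refine (measure_mono fun ω hω => ?_).trans (measure_sum_le_pow_div_factorial hm hlaw hind n hx)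
  simp only [Set.mem_ofPred_eq, not_exists, not_lt] at hω
  exact hω n

theorem measure_countJumps_eq_le [IsProbabilityMeasure P] (hm : ∀ j, Measurable (e j))
    (hlaw : ∀ j, P.map (e j) = expMeasure 1) (hind : iIndepFun e P) {lam : ℝ} (hlam : 0 ≤ lam)
    (n : ℕ) : P {ω | countJumps lam (fun j => e j ω) 1 = n} ≤
      ENNReal.ofReal (lam ^ n / n.factorial) := by
  refine le_trans (measure_mono_ae ?_) (measure_sum_le_pow_div_factorial hm hlaw hind n hlam)
  filter_upwards [ae_nonneg_of_exp hm hlaw, ae_exists_lt_sum_of_exp hm hlaw hind hlam] with ω h0 h1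
  intro (hn : countJumps lam (fun j => e j ω) 1 = n)
  have := (le_countJumps_iff (lam := lam) (t := 1) h0 (by simpa using h1) (by simpa using hlam) n).1
    hn.ge
  rwa [mul_one] at this

theorem lintegral_countJumps_le [IsProbabilityMeasure P]
    (hm : ∀ j, Measurable (e j))
    (hlaw : ∀ j, P.map (e j) = expMeasure 1) (hind : iIndepFun e P) {lam : ℝ} (hlam : 0 ≤ lam) :
    ∫⁻ ω, (countJumps lam (fun j => e j ω) 1 : ℝ≥0∞) ∂P ≤ ENNReal.ofReal lam := by
  have hset : ∀ k, MeasurableSet {ω | ∑ j ∈ Finset.range (k + 1), e j ω ≤ lam} := fun k =>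
    measurableSet_le (by fun_prop) measurable_const
  calc ∫⁻ ω, (countJumps lam (fun j => e j ω) 1 : ℝ≥0∞) ∂P
      ≤ ∫⁻ ω, ∑' k : ℕ, {ω | ∑ j ∈ Finset.range (k + 1), e j ω ≤ lam}.indicator 1 ω ∂P := by
        refine lintegral_mono_ae ?_
        filter_upwards [ae_nonneg_of_exp hm hlaw, ae_exists_lt_sum_of_exp hm hlaw hind hlam]
          with ω h0 h1
        refine le_trans (le_of_eq ?_) (ENNReal.sum_le_tsum
          (Finset.range (countJumps lam (fun j => e j ω) 1)))
        rw [Finset.sum_congr rfl (g := fun _ => 1)]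
        · simp
        · intro k hk
          have := (le_countJumps_iff (lam := lam) (t := 1) h0 (by simpa using h1)
            (by simpa using hlam) (k + 1)).1 (by simpa using hk)
          exact Set.indicator_of_mem (by simpa using this) _
    _ = ∑' k : ℕ, P {ω | ∑ j ∈ Finset.range (k + 1), e j ω ≤ lam} := by
        rw [lintegral_tsum fun k => (measurable_one.indicator (hset k)).aemeasurable]
        simp_rw [lintegral_indicator_one (hset _)]
    _ ≤ ENNReal.ofReal lam :=
        ENNReal.tsum_le_of_sum_range_le fun n => sum_measure_sum_le hm hlaw hind n hlam

end

/-! ### Moments of random sums -/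

/-- Comparison with the largest term works for every `s > 0`, with no distinction between `s ≤ 1`
and `s ≥ 1`. The loss in the power of the cardinality is harmless against `1 / n!`. -/
theorem ENNReal.rpow_sum_le_card_rpow_mul_sum {ι : Type*} (I : Finset ι) (y : ι → ℝ≥0∞) {s : ℝ}
    (hs : 0 < s) : (∑ i ∈ I, y i) ^ s ≤ (I.card : ℝ≥0∞) ^ s * ∑ i ∈ I, y i ^ s := by
  rcases I.eq_empty_or_nonempty with rfl | hI
  · simp [hs]
  obtain ⟨i₀, hi₀, hmax⟩ := I.exists_max_image y hI
  calc (∑ i ∈ I, y i) ^ s ≤ (I.card * y i₀) ^ s := by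
        gcongr
        simpa using Finset.sum_le_card_nsmul I y _ hmax
    _ = (I.card : ℝ≥0∞) ^ s * y i₀ ^ s := ENNReal.mul_rpow_of_nonneg _ _ hs.le
    _ ≤ _ := by
        gcongr
        exact Finset.single_le_sum (f := fun i => y i ^ s) (fun _ _ => zero_le) hi₀

theorem ENNReal.add_rpow_le_two_rpow_mul (a b : ℝ≥0∞) {s : ℝ} (hs : 0 < s) :
    (a + b) ^ s ≤ 2 ^ s * (a ^ s + b ^ s) := by
  simpa using ENNReal.rpow_sum_le_card_rpow_mul_sum Finset.univ ![a, b] hs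

theorem natCast_rpow_mul_natCast_le (n : ℕ) {s : ℝ} (hs : 0 < s) :
    (n : ℝ≥0∞) ^ s * n ≤ ENNReal.ofReal (Real.exp ((s + 1) * n)) := by
  have h : (n : ℝ) ≤ Real.exp n := by linarith [Real.add_one_le_exp (n : ℝ)]
  rw [← ENNReal.ofReal_natCast, ENNReal.ofReal_rpow_of_nonneg (Nat.cast_nonneg n) hs.le,
    ← ENNReal.ofReal_mul (by positivity)]
  refine ENNReal.ofReal_le_ofReal ?_
  calc (n : ℝ) ^ s * n ≤ (Real.exp n) ^ s * Real.exp n := by gcongr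
    _ = _ := by rw [← Real.exp_mul, ← Real.exp_add]; ring_nf

theorem tsum_ofReal_pow_div_factorial {x b : ℝ} (hx : 0 ≤ x) :
    ∑' n : ℕ, ENNReal.ofReal (x ^ n / n.factorial) * ENNReal.ofReal (Real.exp (b * n)) =
      ENNReal.ofReal (Real.exp (x * Real.exp b)) := by
  have h : ∀ n : ℕ, ENNReal.ofReal (x ^ n / n.factorial) * ENNReal.ofReal (Real.exp (b * n)) =
      ENNReal.ofReal ((x * Real.exp b) ^ n / n.factorial) := by
    intro n
    rw [← ENNReal.ofReal_mul (by positivity), mul_pow, ← Real.exp_nat_mul, mul_comm b]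
    congr 1
    ring
  have hsum := NormedSpace.expSeries_div_hasSum_exp (x * Real.exp b)
  rw [← Real.exp_eq_exp_ℝ] at hsum
  simp_rw [h]
  rw [← ENNReal.ofReal_tsum_of_nonneg (fun n => by positivity) hsum.summable, hsum.tsum_eq]

namespace IsCompoundPoisson

variable {Ω : Type*} [MeasurableSpace Ω] {P : Measure Ω} {d : ℕ} {lam : ℝ}
  {e : ℕ → Ω → ℝ} {Z : ℕ → Ω → (Fin d → ℝ)} {X : Ω → JumpPath (Fin d → ℝ)}

theorem measurable_countJumps (h : IsCompoundPoisson P lam e Z X) (t : ℝ) :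
    Measurable fun ω => countJumps lam (fun j => e j ω) t :=
  (_root_.measurable_countJumps lam t).comp (measurable_pi_lambda _ h.measurable_e)

theorem measurableSet_countJumps_eq (h : IsCompoundPoisson P lam e Z X) (t : ℝ) (n : ℕ) :
    MeasurableSet {ω | countJumps lam (fun j => e j ω) t = n} :=
  h.measurable_countJumps t (measurableSet_singleton n)

theorem lintegral_comp_Z (h : IsCompoundPoisson P lam e Z X) {f : (Fin d → ℝ) → ℝ≥0∞}
    (hf : Measurable f) (i : ℕ) : ∫⁻ ω, f (Z i ω) ∂P = ∫⁻ ω, f (Z 0 ω) ∂P :=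
  ((h.identDistrib_Z i).comp hf).lintegral_eq

/-- The number of jumps is a function of `e` alone, so the integral factors into the probability of
the event and a moment of the increments. -/
theorem setLIntegral_rpow_sum_le [IsProbabilityMeasure P] (h : IsCompoundPoisson P lam e Z X) {s : ℝ} (hs : 0 < s)
    {f : (Fin d → ℝ) → ℝ≥0∞} (hf : Measurable f) (n : ℕ) :
    ∫⁻ ω in {ω | countJumps lam (fun j => e j ω) 1 = n}, (∑ i ∈ Finset.range n, f (Z i ω)) ^ s ∂P ≤
      ENNReal.ofReal (lam ^ n / n.factorial) * ENNReal.ofReal (Real.exp ((s + 1) * n)) *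
        ∫⁻ ω, f (Z 0 ω) ^ s ∂P := by
  have hset := h.measurableSet_countJumps_eq 1 n
  have hF : Measurable fun z : ℕ → Fin d → ℝ => (∑ i ∈ Finset.range n, f (z i)) ^ s := by fun_prop
  have hG : Measurable fun y : ℕ → ℝ => ({n} : Set ℕ).indicator (1 : ℕ → ℝ≥0∞) (countJumps lam y 1) :=
    (measurable_one.indicator (measurableSet_singleton n)).comp
      (_root_.measurable_countJumps lam 1)
  have hZ := h.measurable_Z
  have hindep := h.indep_e_Z.comp hG hF
  have hprod := lintegral_mul_eq_lintegral_mul_lintegral_of_indepFun''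
    (hG.comp (measurable_pi_lambda _ h.measurable_e)).aemeasurable
    (hF.comp (measurable_pi_lambda _ h.measurable_Z)).aemeasurable hindep
  have e1 : ∫⁻ ω in {ω | countJumps lam (fun j => e j ω) 1 = n},
      (∑ i ∈ Finset.range n, f (Z i ω)) ^ s ∂P = ∫⁻ ω,
      ({n} : Set ℕ).indicator (1 : ℕ → ℝ≥0∞) (countJumps lam (fun j => e j ω) 1) *
        (∑ i ∈ Finset.range n, f (Z i ω)) ^ s ∂P := by
    rw [← lintegral_indicator hset]
    refine lintegral_congr fun ω => ?_
    simp [Set.indicator]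
  have e2 : ∫⁻ ω, ({n} : Set ℕ).indicator (1 : ℕ → ℝ≥0∞) (countJumps lam (fun j => e j ω) 1) ∂P =
      P {ω | countJumps lam (fun j => e j ω) 1 = n} := by
    rw [← lintegral_indicator_one hset]
    refine lintegral_congr fun ω => ?_
    simp [Set.indicator]
  simp only [Function.comp_def] at hprod
  rw [e1, hprod, e2, mul_assoc]
  gcongr
  · exact measure_countJumps_eq_le h.measurable_e h.law_e h.indep_e h.lam_pos.le n
  calc ∫⁻ ω, (∑ i ∈ Finset.range n, f (Z i ω)) ^ s ∂P
      ≤ ∫⁻ ω, (n : ℝ≥0∞) ^ s * ∑ i ∈ Finset.range n, f (Z i ω) ^ s ∂P := by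
        refine lintegral_mono fun ω => ?_
        simpa using ENNReal.rpow_sum_le_card_rpow_mul_sum (Finset.range n) (fun i => f (Z i ω)) hs
    _ = (n : ℝ≥0∞) ^ s * (n * ∫⁻ ω, f (Z 0 ω) ^ s ∂P) := by
        rw [lintegral_const_mul _ (by fun_prop), lintegral_finsetSum _ (by fun_prop)]
        rw [Finset.sum_congr rfl fun i _ =>
          h.lintegral_comp_Z (f := fun z => f z ^ s) (by fun_prop) i]
        simp
    _ ≤ _ := by
        rw [← mul_assoc]
        gcongr
        exact natCast_rpow_mul_natCast_le n hs

theorem lintegral_eq_tsum (h : IsCompoundPoisson P lam e Z X) (g : Ω → ℝ≥0∞) :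
    ∫⁻ ω, g ω ∂P = ∑' n : ℕ, ∫⁻ ω in {ω | countJumps lam (fun j => e j ω) 1 = n}, g ω ∂P := by
  rw [← lintegral_iUnion (fun n => h.measurableSet_countJumps_eq 1 n)]
  · rw [← setLIntegral_univ]
    congr 2
    ext ω
    simp
  · intro m n hmn
    refine Set.disjoint_left.2 fun ω (h1 : _ = m) (h2 : _ = n) => hmn (h1.symm.trans h2)

end IsCompoundPoisson

/-! ### Step paths on a grid -/

/-- The path with jump `z i` at time `τ i`. -/
noncomputable def stepPath {E : Type*} [AddCommMonoid E] {n : ℕ} (τ : Fin n → Set.Ico (0 : ℝ) 1)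
    (z : Fin n → E) : JumpPath E :=
  ⟨fun t => ∑ i, if τ i ≤ t then z i else 0, by
    classical
    refine ⟨Finset.univ.image τ, fun u t hut h => Finset.sum_congr rfl fun i _ => ?_⟩
    have hi := h (τ i) (Finset.mem_image_of_mem _ (Finset.mem_univ i))
    by_cases h1 : τ i ≤ u
    · rw [if_pos h1, if_pos (h1.trans hut)]
    · rw [if_neg h1, if_neg (not_le.2 (hi.resolve_left h1))]⟩

/-- At a time between `T i` and `τ i` exactly one of the paths may have made jump `i`, and `‖z i‖ ≤
‖x i‖ + ‖x i - z i‖`. Hence `‖x i‖` is charged only on an interval of length `|T i - τ i|`, and `‖x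
i - z i‖` over the whole unit interval. The times need be neither ordered nor distinct, so rounding
them independently is allowed. -/
theorem pathDistortion_stepPath_le {d n : ℕ} {f : JumpPath (Fin d → ℝ)} {T : Fin n → ℝ}
    {x : Fin n → Fin d → ℝ} (hf : ∀ t, f.1 t = ∑ i, if T i ≤ (t : ℝ) then x i else 0)
    (τ : Fin n → Set.Ico (0 : ℝ) 1) (z : Fin n → Fin d → ℝ) :
    pathDistortion (supDist d) f (stepPath τ z) ≤
      ∑ i, (ENNReal.ofReal |T i - τ i| * ENNReal.ofReal ‖x i‖ + supDist d (x i) (z i)) := by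
  have hpt : ∀ t : Set.Ico (0 : ℝ) 1, supDist d (f.1 t) ((stepPath τ z).1 t) ≤
      ∑ i, ((Set.uIcc (T i) (τ i)).indicator 1 (t : ℝ) * ENNReal.ofReal ‖x i‖
        + supDist d (x i) (z i)) := by
    intro t
    have hterm : ∀ i, ENNReal.ofReal ‖(if T i ≤ (t : ℝ) then x i else 0) -
        (if τ i ≤ t then z i else 0)‖ ≤ (Set.uIcc (T i) (τ i)).indicator 1 (t : ℝ) *
          ENNReal.ofReal ‖x i‖ + supDist d (x i) (z i) := by
      intro i
      have hτ : τ i ≤ t ↔ (τ i : ℝ) ≤ t := Iff.rfl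
      by_cases h1 : T i ≤ (t : ℝ) <;> by_cases h2 : τ i ≤ t
      · simp [h1, h2, supDist]
      · have hmem : (t : ℝ) ∈ Set.uIcc (T i) (τ i) :=
          Set.mem_uIcc.2 (Or.inl ⟨h1, (not_le.1 (hτ.not.1 h2)).le⟩)
        simp [h1, h2, Set.indicator_of_mem hmem]
      · have hmem : (t : ℝ) ∈ Set.uIcc (T i) (τ i) :=
          Set.mem_uIcc.2 (Or.inr ⟨hτ.1 h2, (not_le.1 h1).le⟩)
        rw [if_neg h1, if_pos h2, Set.indicator_of_mem hmem, supDist, Pi.one_apply, one_mul,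
          ← ENNReal.ofReal_add (norm_nonneg _) (norm_nonneg _)]
        refine ENNReal.ofReal_le_ofReal ?_
        calc ‖0 - z i‖ = ‖(x i - z i) - x i‖ := by congr 1; abel
          _ ≤ _ := by rw [add_comm]; exact norm_sub_le _ _
      · simp [h1, h2]
    rw [supDist, hf t]
    simp only [stepPath, ← Finset.sum_sub_distrib]
    refine (ENNReal.ofReal_le_ofReal (norm_sum_le _ _)).trans ?_
    rw [ENNReal.ofReal_sum_of_nonneg fun _ _ => norm_nonneg _]
    exact Finset.sum_le_sum fun i _ => hterm i
  refine (lintegral_mono hpt).trans ?_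
  rw [lintegral_subtype_comap measurableSet_Ico
    (fun t : ℝ => ∑ i, ((Set.uIcc (T i) (τ i)).indicator 1 t * ENNReal.ofReal ‖x i‖
        + supDist d (x i) (z i)))]
  have hmeas : ∀ i, Measurable fun t : ℝ =>
      (Set.uIcc (T i) (τ i)).indicator (1 : ℝ → ℝ≥0∞) t * ENNReal.ofReal ‖x i‖ := fun i =>
    (measurable_one.indicator measurableSet_uIcc).mul_const _
  rw [lintegral_finsetSum _ fun i _ => (hmeas i).add_const _]
  refine Finset.sum_le_sum fun i _ => ?_
  rw [lintegral_add_right _ measurable_const, lintegral_mul_const _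
    (measurable_one.indicator measurableSet_uIcc)]
  gcongr
  · calc ∫⁻ t in Set.Ico (0 : ℝ) 1, (Set.uIcc (T i) (τ i)).indicator 1 t
        ≤ ∫⁻ t, (Set.uIcc (T i) (τ i)).indicator 1 t := setLIntegral_le_lintegral _ _
      _ = _ := by
        rw [lintegral_indicator_one measurableSet_uIcc, Set.uIcc, Real.volume_Icc]
        simp [max_sub_min_eq_abs, abs_sub_comm]
  · simp

theorem stepPath_zero_eq {E : Type*} [AddCommMonoid E] {n : ℕ} (τ : Fin n → Set.Ico (0 : ℝ) 1) :
    stepPath τ (fun _ => (0 : E)) = stepPath (n := 0) Fin.elim0 Fin.elim0 := by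
  ext t
  simp [stepPath]

/-- The grid point `k / K` in `[0, 1[`. -/
noncomputable def gridPoint {K : ℕ} (k : Fin K) : Set.Ico (0 : ℝ) 1 :=
  ⟨k / K, by positivity, by
    have hk : (k : ℝ) < K := by exact_mod_cast k.2
    exact (div_lt_one ((Nat.cast_nonneg _).trans_lt hk)).2 hk⟩

/-- The index of the last grid point of mesh `1 / K` before `x`. -/
noncomputable def gridIndex (K : ℕ) [NeZero K] (x : ℝ) : Fin K :=
  -- The cap at `K - 1` serves `x = 1`: jumps are counted up to and including time `1`, while the
  -- grid lies in `[0,1[`.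
  ⟨min ⌊K * x⌋₊ (K - 1), by have := NeZero.pos K; omega⟩

theorem measurable_gridIndex (K : ℕ) [NeZero K] : Measurable (gridIndex K) := by
  refine measurable_to_countable' fun k => ?_
  have : gridIndex K ⁻¹' {k} = (fun x : ℝ => min ⌊K * x⌋₊ (K - 1)) ⁻¹' {(k : ℕ)} := by
    ext x
    simp [gridIndex, Fin.ext_iff]
  rw [this]
  exact ((Nat.measurable_floor.comp (measurable_const_mul (K : ℝ))).min measurable_const)
    (measurableSet_singleton _)

theorem abs_sub_gridPoint_le {K : ℕ} [NeZero K] {x : ℝ} (h0 : 0 ≤ x) (h1 : x ≤ 1) :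
    |x - gridPoint (gridIndex K x)| ≤ 1 / K := by
  have hK : (0 : ℝ) < K := by exact_mod_cast NeZero.pos K
  have hK1 : ((K - 1 : ℕ) : ℝ) = K - 1 := by
    rw [Nat.cast_sub (NeZero.one_le), Nat.cast_one]
  have hfl : (⌊K * x⌋₊ : ℝ) ≤ K * x := Nat.floor_le (by positivity)
  have hlt : K * x < ⌊K * x⌋₊ + 1 := Nat.lt_floor_add_one _
  have hKx : K * x ≤ K := by nlinarith
  have key : |K * x - ((min ⌊K * x⌋₊ (K - 1) : ℕ) : ℝ)| ≤ 1 := by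
    rw [abs_le]
    rcases le_total ⌊K * x⌋₊ (K - 1) with h | h
    · rw [min_eq_left h]
      constructor <;> linarith
    · have h' : ((K - 1 : ℕ) : ℝ) ≤ ⌊K * x⌋₊ := by exact_mod_cast h
      rw [min_eq_right h]
      rw [hK1] at h' ⊢
      constructor <;> linarith
  have : x - gridPoint (gridIndex K x) = (K * x - ((min ⌊K * x⌋₊ (K - 1) : ℕ) : ℝ)) / K := by
    simp only [gridPoint, gridIndex]
    field_simp
  rw [this, abs_div, abs_of_pos hK]
  gcongr

namespace IsCompoundPoisson

variable {Ω : Type*} [MeasurableSpace Ω] {P : Measure Ω} {d : ℕ} {lam : ℝ}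
  {e : ℕ → Ω → ℝ} {Z : ℕ → Ω → (Fin d → ℝ)} {X : Ω → JumpPath (Fin d → ℝ)}

theorem ae_pathDistortion_le [IsProbabilityMeasure P] (h : IsCompoundPoisson P lam e Z X) :
    ∀ᵐ ω ∂P, ∀ (K : ℕ) [NeZero K] (n : ℕ), countJumps lam (fun j => e j ω) 1 = n →
      ∀ z : Fin n → Fin d → ℝ, pathDistortion (supDist d) (X ω)
        (stepPath (fun i : Fin n => gridPoint (gridIndex K
          ((∑ j ∈ Finset.range (i + 1), e j ω) / lam))) z) ≤
        ∑ i : Fin n, (ENNReal.ofReal (1 / K) * ENNReal.ofReal ‖Z i ω‖ +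
          supDist d (Z i ω) (z i)) := by
  filter_upwards [ae_nonneg_of_exp h.measurable_e h.law_e, h.X_eq,
    ae_exists_lt_sum_of_exp h.measurable_e h.law_e h.indep_e h.lam_pos.le] with ω h0 hX hex
  intro K _ n hn z
  have hf : ∀ t, (X ω).1 t = ∑ i : Fin n,
      if (∑ j ∈ Finset.range (i + 1), e j ω) / lam ≤ (t : ℝ) then Z i ω else 0 := by
    intro t
    rw [hX t, sum_range_countJumps h.lam_pos.le h0 hex t.2.1 t.2.2.le, hn, Finset.sum_range]
    simp_rw [div_le_iff₀' h.lam_pos]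
  refine (pathDistortion_stepPath_le hf _ z).trans (Finset.sum_le_sum fun i _ => ?_)
  gcongr
  refine abs_sub_gridPoint_le (div_nonneg (Finset.sum_nonneg fun j _ => h0 j) h.lam_pos.le) ?_
  rw [div_le_one h.lam_pos]
  have hi : (i : ℕ) + 1 ≤ countJumps lam (fun j => e j ω) 1 := by rw [hn]; exact i.2
  simpa using (le_countJumps_iff (lam := lam) (t := 1) h0 (by simpa using hex)
    (by simpa using h.lam_pos.le) (i + 1)).1 hi

end IsCompoundPoisson

/-! ### Entropy of functions of countable random variables -/

section
variable {Ω ι E : Type*} [MeasurableSpace Ω] {P : Measure Ω} {W : Ω → ι}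

theorem tsum_mul_measure_preimage_singleton [Countable ι] (hW : ∀ w, MeasurableSet (W ⁻¹' {w}))
    (f : ι → ℝ≥0∞) : ∑' w, f w * P (W ⁻¹' {w}) = ∫⁻ ω, f (W ω) ∂P := by
  let _ : MeasurableSpace ι := ⊤
  have hWm : Measurable W := measurable_to_countable' hW
  rw [← lintegral_map (μ := P) (f := f) (g := W) (measurable_from_top) hWm, lintegral_countable']
  refine tsum_congr fun w => ?_
  rw [Measure.map_apply hWm (MeasurableSet.singleton w)]

theorem ofReal_negMulLog_eq {p : ℝ} (h0 : 0 ≤ p) :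
    ENNReal.ofReal (Real.negMulLog p) = ENNReal.ofReal (-Real.log p) * ENNReal.ofReal p := by
  rw [Real.negMulLog, ← ENNReal.ofReal_mul' h0]
  congr 1
  ring

theorem negMulLog_add_le {p q : ℝ} (hp : 0 ≤ p) (hq : 0 < q) :
    Real.negMulLog p + p ≤ -Real.log q * p + q := by
  rcases hp.eq_or_lt with rfl | hp
  · simp [hq.le]
  have h := Real.log_le_sub_one_of_pos (div_pos hq hp)
  rw [Real.log_div hq.ne' hp.ne'] at h
  have h2 : p * (Real.log q - Real.log p) ≤ p * (q / p - 1) := by gcongr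
  have h3 : p * (q / p - 1) = q - p := by field_simp
  rw [Real.negMulLog]
  linarith

/-- Gibbs' inequality for `W`, together with the fact that a function of `W` has no more entropy
than `W`: on the fibre of `g` over `x`, each atom of `W` has probability at most that of `x`. -/
theorem discreteEntropy_comp_le [IsProbabilityMeasure P] [Countable ι]
    (hW : ∀ w, MeasurableSet (W ⁻¹' {w})) (g : ι → E) {q : ι → ℝ} (hq0 : ∀ w, 0 < q w)
    (hq : ∑' w, ENNReal.ofReal (q w) ≤ 1) :
    discreteEntropy P (g ∘ W) ≤ ∫⁻ ω, ENNReal.ofReal (-Real.log (q (W ω))) ∂P := by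
  classical
  have hcond : ∃ S : Set E, S.Countable ∧ ∀ᵐ ω ∂P, (g ∘ W) ω ∈ S :=
    ⟨Set.range g, Set.countable_range g, Eventually.of_forall fun ω => ⟨W ω, rfl⟩⟩
  have hone : ∑' w, P (W ⁻¹' {w}) = 1 := by
    simpa using tsum_mul_measure_preimage_singleton (P := P) hW (fun _ => 1)
  have hq1 : ∀ w, q w ≤ 1 := fun w =>
    ENNReal.ofReal_le_one.1 ((ENNReal.le_tsum w).trans hq)
  have hgibbs : ∑' w, ENNReal.ofReal (Real.negMulLog (P.real (W ⁻¹' {w}))) ≤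
      ∑' w, ENNReal.ofReal (-Real.log (q w)) * P (W ⁻¹' {w}) := by
    -- Adding the total mass `1` to both sides turns Gibbs' inequality into the termwise bound of
    -- `negMulLog_add_le` between nonnegative quantities.
    refine (ENNReal.add_le_add_iff_right ENNReal.one_ne_top).1 ?_
    calc ∑' w, ENNReal.ofReal (Real.negMulLog (P.real (W ⁻¹' {w}))) + 1
        = ∑' w, (ENNReal.ofReal (Real.negMulLog (P.real (W ⁻¹' {w}))) + P (W ⁻¹' {w})) := by
          rw [ENNReal.tsum_add, hone]
      _ ≤ ∑' w, (ENNReal.ofReal (-Real.log (q w)) * P (W ⁻¹' {w}) + ENNReal.ofReal (q w)) := by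
          refine ENNReal.tsum_le_tsum fun w => ?_
          have hp0 : 0 ≤ P.real (W ⁻¹' {w}) := measureReal_nonneg
          have hl : 0 ≤ -Real.log (q w) := by
            have := Real.log_nonpos (hq0 w).le (hq1 w)
            linarith
          rw [← ofReal_measureReal (μ := P) (s := W ⁻¹' {w}), ← ENNReal.ofReal_mul hl,
            ← ENNReal.ofReal_add (Real.negMulLog_nonneg hp0 measureReal_le_one) hp0,
            ← ENNReal.ofReal_add (mul_nonneg hl hp0) (hq0 w).le]
          exact ENNReal.ofReal_le_ofReal (negMulLog_add_le hp0 (hq0 w))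
      _ ≤ _ := by
          rw [ENNReal.tsum_add]
          gcongr
  rw [discreteEntropy, if_pos hcond, ← tsum_mul_measure_preimage_singleton hW
    (fun w => ENNReal.ofReal (-Real.log (q w)))]
  refine le_trans ?_ hgibbs
  have hfib : ∀ x, P ((g ∘ W) ⁻¹' {x}) = ∑' w : {w // g w = x}, P (W ⁻¹' {w.1}) := by
    intro x
    rw [← measure_iUnion]
    · congr 1
      ext ω
      simp
    · intro a b hab
      refine Set.disjoint_left.2 fun ω (h1 : _ = _) (h2 : _ = _) => hab (Subtype.ext (h1.symm.trans h2))
    · exact fun w => hW w.1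
  calc ∑' x, ENNReal.ofReal (Real.negMulLog (P.real ((g ∘ W) ⁻¹' {x})))
      = ∑' x, ∑' w : {w // g w = x},
          ENNReal.ofReal (-Real.log (P.real ((g ∘ W) ⁻¹' {x}))) * P (W ⁻¹' {w.1}) := by
        refine tsum_congr fun x => ?_
        rw [ofReal_negMulLog_eq measureReal_nonneg, ofReal_measureReal, ENNReal.tsum_mul_left, hfib]
    _ ≤ ∑' x, ∑' w : {w // g w = x}, ENNReal.ofReal (Real.negMulLog (P.real (W ⁻¹' {w.1}))) := by
        refine ENNReal.tsum_le_tsum fun x => ENNReal.tsum_le_tsum fun w => ?_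
        rw [ofReal_negMulLog_eq measureReal_nonneg, ofReal_measureReal]
        rcases eq_or_ne (P (W ⁻¹' {w.1})) 0 with h0 | h0
        · simp [h0]
        have hpos : 0 < P.real (W ⁻¹' {w.1}) := ENNReal.toReal_pos h0 (measure_ne_top P _)
        have hsub : W ⁻¹' {w.1} ⊆ (g ∘ W) ⁻¹' {x} := fun ω (hω : W ω = w.1) => by
          simp [hω, w.2]
        gcongr
        exact measure_ne_top P _
    _ = ∑' w, ENNReal.ofReal (Real.negMulLog (P.real (W ⁻¹' {w}))) := by
        rw [← ENNReal.tsum_sigma (fun x (w : {w // g w = x}) =>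
          ENNReal.ofReal (Real.negMulLog (P.real (W ⁻¹' {w.1}))))]
        exact (Equiv.sigmaFiberEquiv g).tsum_eq
          (fun w => ENNReal.ofReal (Real.negMulLog (P.real (W ⁻¹' {w}))))

theorem measurableSet_preimage_sigma_mk {α : Type*} {N : Ω → ℕ}
    (hN : ∀ n, MeasurableSet (N ⁻¹' {n})) {c : ℕ → Ω → α}
    (hc : ∀ i x, MeasurableSet (c i ⁻¹' {x})) (w : Σ n, Fin n → α) :
    MeasurableSet ((fun ω => (⟨N ω, fun i => c i ω⟩ : Σ n, Fin n → α)) ⁻¹' {w}) := by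
  obtain ⟨n, a⟩ := w
  have : (fun ω => (⟨N ω, fun i => c i ω⟩ : Σ n, Fin n → α)) ⁻¹' {⟨n, a⟩} =
      N ⁻¹' {n} ∩ ⋂ i : Fin n, c i ⁻¹' {a i} := by
    ext ω
    simp only [Set.mem_preimage, Set.mem_singleton_iff, Set.mem_inter_iff, Set.mem_iInter]
    constructor
    · intro h
      obtain ⟨h1, h2⟩ := Sigma.mk.inj_iff.1 h
      subst h1
      exact ⟨rfl, fun i => congrFun (eq_of_heq h2) i⟩
    · rintro ⟨rfl, h2⟩
      exact Sigma.ext rfl (heq_of_eq (funext h2))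
  rw [this]
  exact (hN n).inter (MeasurableSet.iInter fun i => hc i _)

/-- A random variable with random length `N` and letters in an alphabet of `A` elements. -/
theorem discreteEntropy_comp_sigma_le [IsProbabilityMeasure P] {α : Type*} [Fintype α] [Nonempty α]
    {N : Ω → ℕ} (hN : ∀ n, MeasurableSet (N ⁻¹' {n})) {c : ℕ → Ω → α}
    (hc : ∀ i x, MeasurableSet (c i ⁻¹' {x})) (g : (Σ n, Fin n → α) → E) {lam : ℝ} (hlam : 0 ≤ lam)
    (hNlam : ∫⁻ ω, (N ω : ℝ≥0∞) ∂P ≤ ENNReal.ofReal lam) :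
    discreteEntropy P (fun ω => g ⟨N ω, fun i => c i ω⟩) ≤
      ENNReal.ofReal (Real.log 2 + lam * (Real.log 2 + Real.log (Fintype.card α))) := by
  have hA : (1 : ℝ) ≤ Fintype.card α := by exact_mod_cast Fintype.card_pos
  have hA0 : (0 : ℝ) < Fintype.card α := by linarith
  have hl2 : 0 ≤ Real.log 2 := Real.log_nonneg one_le_two
  have hlA : 0 ≤ Real.log (Fintype.card α) := Real.log_nonneg hA
  set W : Ω → Σ n, Fin n → α := fun ω => ⟨N ω, fun i => c i ω⟩ with hWdef
  have hW : ∀ w, MeasurableSet (W ⁻¹' {w}) := measurableSet_preimage_sigma_mk hN hc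
  -- The comparison law has geometric length and, given the length, independent uniform letters;
  -- `-log q` is then affine in the length, so only the mean of `N` enters.
  set q : (Σ n, Fin n → α) → ℝ := fun w => (1 / 2) ^ (w.1 + 1) * ((Fintype.card α : ℝ) ^ w.1)⁻¹
  have hq0 : ∀ w, 0 < q w := fun w => by positivity
  have hq : ∑' w, ENNReal.ofReal (q w) ≤ 1 := by
    rw [ENNReal.tsum_sigma']
    have : ∀ n : ℕ, ∑' a : Fin n → α, ENNReal.ofReal (q ⟨n, a⟩) = ENNReal.ofReal ((1 / 2) ^ (n + 1)) := by
      intro n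
      rw [tsum_fintype]
      simp only [q]
      rw [Finset.sum_const, nsmul_eq_mul, ← ENNReal.ofReal_natCast,
        ← ENNReal.ofReal_mul (Nat.cast_nonneg _)]
      congr 1
      simp
      field_simp
    simp_rw [this]
    rw [← ENNReal.ofReal_tsum_of_nonneg (fun n => by positivity)]
    · simp only [pow_succ, tsum_mul_right, tsum_geometric_two]
      norm_num
    · simp only [pow_succ]
      exact summable_geometric_two.mul_right _
  have hlog : ∀ ω, -Real.log (q (W ω)) =
      Real.log 2 + N ω * (Real.log 2 + Real.log (Fintype.card α)) := by
    intro ω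
    simp only [q, hWdef]
    rw [Real.log_mul (by positivity) (by positivity), Real.log_inv, Real.log_pow, Real.log_pow,
      one_div, Real.log_inv]
    push_cast
    ring
  refine (discreteEntropy_comp_le hW g hq0 hq).trans ?_
  have hNm : Measurable N := measurable_to_countable' hN
  calc ∫⁻ ω, ENNReal.ofReal (-Real.log (q (W ω))) ∂P
      = ∫⁻ ω, (ENNReal.ofReal (Real.log 2) +
          N ω * ENNReal.ofReal (Real.log 2 + Real.log (Fintype.card α))) ∂P := by
        refine lintegral_congr fun ω => ?_
        rw [hlog, ENNReal.ofReal_add hl2 (by positivity), ENNReal.ofReal_mul (by positivity),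
          ENNReal.ofReal_natCast]
    _ = ENNReal.ofReal (Real.log 2) + (∫⁻ ω, (N ω : ℝ≥0∞) ∂P) *
          ENNReal.ofReal (Real.log 2 + Real.log (Fintype.card α)) := by
        rw [lintegral_add_left measurable_const, lintegral_mul_const _ (by fun_prop)]
        simp
    _ ≤ _ := by
        rw [ENNReal.ofReal_add hl2 (mul_nonneg hlam (add_nonneg hl2 hlA)), ENNReal.ofReal_mul hlam]
        gcongr

end

/-! ### Codebooks for the increments -/

section
variable {Ω E : Type*} [MeasurableSpace Ω] {P : Measure Ω} {X : Ω → E} {ρ : E → E → ℝ≥0∞} {s : ℝ}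

theorem exists_codebook_of_quantError_lt (hs : 0 < s) {r : ℝ} {ε : ℝ≥0∞}
    (h : quantError P X ρ s r < ε) : ∃ C : Finset E, C.Nonempty ∧ Real.log C.card ≤ r ∧
      ∫⁻ ω, (⨅ a ∈ C, ρ (X ω) a) ^ s ∂P ≤ ε ^ s := by
  simp only [quantError, iInf_lt_iff] at h
  obtain ⟨C, ⟨hC, hr⟩, hlt⟩ := h
  refine ⟨C, hC, hr, ?_⟩
  have := ENNReal.rpow_le_rpow hlt.le hs.le
  rwa [← ENNReal.rpow_mul, one_div_mul_cancel hs.ne', ENNReal.rpow_one] at this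

/-- The quantization error is an infimum that need not be attained, so a codebook of the same size
is obtained only at precision `2 * ε`. -/
theorem exists_codebook_of_quantNumber_lt_top (hs : 0 < s) {ε : ℝ} (hε : 0 < ε)
    (h : quantNumber P X ρ s ε < ⊤) : ∃ C : Finset E, C.Nonempty ∧
      C.card ≤ (quantNumber P X ρ s ε).toNat ∧
      ∫⁻ ω, (⨅ a ∈ C, ρ (X ω) a) ^ s ∂P ≤ ENNReal.ofReal (2 * ε) ^ s := by
  set n := (quantNumber P X ρ s ε).toNat with hn
  have hcoe : (n : ℕ∞) = quantNumber P X ρ s ε := ENat.natCast_toNat h.ne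
  have hlt : quantNumber P X ρ s ε < ((n + 1 : ℕ) : ℕ∞) := by
    rw [← hcoe]
    exact_mod_cast Nat.lt_succ_self n
  rw [quantNumber] at hlt
  simp only [iInf_lt_iff] at hlt
  obtain ⟨m, ⟨hm1, hm⟩, hmn⟩ := hlt
  have hmn' : m ≤ n := Nat.lt_succ_iff.1 (by exact_mod_cast hmn)
  obtain ⟨C, hC, hlog, hint⟩ := exists_codebook_of_quantError_lt hs
    (hm.trans_lt ((ENNReal.ofReal_lt_ofReal_iff (by linarith)).2 (by linarith : ε < 2 * ε)))
  refine ⟨C, hC, ?_, hint⟩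
  have hc0 : (0 : ℝ) < C.card := by exact_mod_cast hC.card_pos
  have := (Real.log_le_log_iff hc0 (by exact_mod_cast hm1)).1 hlog
  exact le_trans (by exact_mod_cast this) hmn'

end

section
variable {d : ℕ}

theorem supDist_eq_edist (x y : Fin d → ℝ) : supDist d x y = edist x y := by
  rw [supDist, edist_dist, dist_eq_norm]

theorem measurable_iInf_supDist (C : Finset (Fin d → ℝ)) :
    Measurable fun x => ⨅ a ∈ C, supDist d x a := by
  refine Measurable.biInf (C : Set (Fin d → ℝ)) C.countable_toSet fun a _ => ?_
  unfold supDist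
  fun_prop

/-- A finite codebook is bounded, so finite distortion forces a finite moment; this is why neither
part has to assume one. -/
theorem lintegral_norm_rpow_lt_top {Ω : Type*} [MeasurableSpace Ω] {P : Measure Ω}
    [IsFiniteMeasure P] {Z : Ω → Fin d → ℝ} {s : ℝ} (hs : 0 < s) {C : Finset (Fin d → ℝ)}
    (hC : C.Nonempty) (h : ∫⁻ ω, (⨅ a ∈ C, supDist d (Z ω) a) ^ s ∂P < ⊤) :
    ∫⁻ ω, ENNReal.ofReal ‖Z ω‖ ^ s ∂P < ⊤ := by
  set B : ℝ≥0∞ := ∑ a ∈ C, ENNReal.ofReal ‖a‖ with hB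
  have hBtop : B < ⊤ := ENNReal.sum_lt_top.2 fun _ _ => ENNReal.ofReal_lt_top
  have hpt : ∀ ω, ENNReal.ofReal ‖Z ω‖ ^ s ≤
      2 ^ s * ((⨅ a ∈ C, supDist d (Z ω) a) ^ s + B ^ s) := by
    intro ω
    refine le_trans ?_ (ENNReal.add_rpow_le_two_rpow_mul _ _ hs)
    gcongr
    obtain ⟨a, ha, hmin⟩ := C.exists_min_image (fun a => supDist d (Z ω) a) hC
    calc ENNReal.ofReal ‖Z ω‖ ≤ supDist d (Z ω) a + ENNReal.ofReal ‖a‖ := by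
          rw [supDist, ← ENNReal.ofReal_add (norm_nonneg _) (norm_nonneg _)]
          exact ENNReal.ofReal_le_ofReal (by simpa using norm_add_le (Z ω - a) a)
      _ ≤ _ := by
          gcongr
          · exact le_iInf₂ hmin
          · exact Finset.single_le_sum (f := fun a => ENNReal.ofReal ‖a‖) (fun _ _ => zero_le) ha
  refine (lintegral_mono hpt).trans_lt ?_
  rw [lintegral_const_mul' _ _ (by finiteness), lintegral_add_right _ measurable_const]
  refine ENNReal.mul_lt_top (by finiteness) (ENNReal.add_lt_top.2 ⟨h, ?_⟩)
  rw [lintegral_const]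
  exact ENNReal.mul_lt_top (ENNReal.rpow_lt_top_of_nonneg hs.le hBtop.ne) (measure_lt_top _ _)

/-- The distortion of a letter that is coded by a jump time with error at most `1 / K` and by a
nearest point of `C`. -/
noncomputable def letterDistortion (K : ℕ) (C : Finset (Fin d → ℝ)) (x : Fin d → ℝ) : ℝ≥0∞ :=
  ENNReal.ofReal (1 / K) * ENNReal.ofReal ‖x‖ + ⨅ a ∈ C, supDist d x a

theorem measurable_letterDistortion (K : ℕ) (C : Finset (Fin d → ℝ)) :
    Measurable (letterDistortion K C) :=
  Measurable.add (by fun_prop) (measurable_iInf_supDist C)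

theorem lintegral_letterDistortion_rpow_le {Ω : Type*} [MeasurableSpace Ω] {P : Measure Ω}
    {Z : Ω → Fin d → ℝ} (hZ : Measurable Z) {s : ℝ} (hs : 0 < s) (K : ℕ)
    (C : Finset (Fin d → ℝ)) : ∫⁻ ω, letterDistortion K C (Z ω) ^ s ∂P ≤
      2 ^ s * (ENNReal.ofReal (1 / K) ^ s * ∫⁻ ω, ENNReal.ofReal ‖Z ω‖ ^ s ∂P +
        ∫⁻ ω, (⨅ a ∈ C, supDist d (Z ω) a) ^ s ∂P) := by
  have hm := (measurable_iInf_supDist C).comp hZ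
  have h1 : Measurable fun ω => ENNReal.ofReal ‖Z ω‖ ^ s := by fun_prop
  calc _ ≤ ∫⁻ ω, 2 ^ s * (ENNReal.ofReal (1 / K) ^ s * ENNReal.ofReal ‖Z ω‖ ^ s +
        (⨅ a ∈ C, supDist d (Z ω) a) ^ s) ∂P := by
        refine lintegral_mono fun ω => ?_
        rw [← ENNReal.mul_rpow_of_nonneg _ _ hs.le]
        exact ENNReal.add_rpow_le_two_rpow_mul _ _ hs
    _ = _ := by
        rw [lintegral_const_mul' _ _ (by finiteness), lintegral_add_left (h1.const_mul _),
          lintegral_const_mul _ h1]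

theorem exists_measurable_nearest {C : Finset (Fin d → ℝ)} (hC : C.Nonempty) :
    ∃ φ : (Fin d → ℝ) → C, (∀ a, MeasurableSet (φ ⁻¹' {a})) ∧
      ∀ x, supDist d x (φ x) ≤ ⨅ a ∈ C, supDist d x a := by
  obtain ⟨a₀, ha₀⟩ := hC
  set en : ℕ → C := fun k => if h : k < C.card then C.equivFin.symm ⟨k, h⟩ else ⟨a₀, ha₀⟩ with hen
  refine ⟨fun x => en (SimpleFunc.nearestPtInd (fun k => (en k : Fin d → ℝ)) C.card x),
    fun a => ?_, fun x => le_iInf₂ fun a ha => ?_⟩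
  · exact SimpleFunc.measurableSet_preimage (SimpleFunc.nearestPtInd _ C.card) (en ⁻¹' {a})
  · have hk : en (C.equivFin ⟨a, ha⟩) = ⟨a, ha⟩ := by simp [hen]
    have := SimpleFunc.edist_nearestPt_le (fun k => (en k : Fin d → ℝ)) x
      (C.equivFin ⟨a, ha⟩).2.le
    simp only [SimpleFunc.nearestPt, SimpleFunc.map_apply] at this
    rw [hk] at this
    rwa [supDist_eq_edist, supDist_eq_edist, edist_comm, edist_comm x]

end

/-! ### Moment bound for the coded path and entropy coding -/

namespace IsCompoundPoisson

variable {Ω : Type*} [MeasurableSpace Ω] {P : Measure Ω} [IsProbabilityMeasure P] {d : ℕ} {lam : ℝ}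
  {e : ℕ → Ω → ℝ} {Z : ℕ → Ω → (Fin d → ℝ)} {X : Ω → JumpPath (Fin d → ℝ)}

theorem lintegral_rpow_le_tsum (h : IsCompoundPoisson P lam e Z X) {s : ℝ} (hs : 0 < s)
    {f : ℕ → (Fin d → ℝ) → ℝ≥0∞} (hf : ∀ n, Measurable (f n)) {g : Ω → ℝ≥0∞}
    (hg : ∀ᵐ ω ∂P, ∀ n, countJumps lam (fun j => e j ω) 1 = n →
      g ω ≤ ∑ i ∈ Finset.range n, f n (Z i ω)) :
    ∫⁻ ω, g ω ^ s ∂P ≤ ∑' n : ℕ, ENNReal.ofReal (lam ^ n / n.factorial) *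
      ENNReal.ofReal (Real.exp ((s + 1) * n)) * ∫⁻ ω, f n (Z 0 ω) ^ s ∂P := by
  rw [h.lintegral_eq_tsum]
  refine ENNReal.tsum_le_tsum fun n => le_trans ?_ (h.setLIntegral_rpow_sum_le hs (hf n) n)
  refine lintegral_mono_ae ((ae_restrict_iff' (h.measurableSet_countJumps_eq 1 n)).2 ?_)
  filter_upwards [hg] with ω hω hn
  exact ENNReal.rpow_le_rpow (hω n hn) hs.le

theorem entropyError_le (h : IsCompoundPoisson P lam e Z X) {s : ℝ} (hs : 0 < s) (K : ℕ)
    [NeZero K] {C : Finset (Fin d → ℝ)} (hC : C.Nonempty) {r : ℝ}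
    (hr : Real.log 2 + lam * (Real.log 2 + Real.log (K * C.card)) ≤ r) :
    entropyError P X (pathDistortion (supDist d)) s r ≤
      (ENNReal.ofReal (Real.exp (lam * Real.exp (s + 1))) *
        ∫⁻ ω, letterDistortion K C (Z 0 ω) ^ s ∂P) ^ (1 / s) := by
  have : Nonempty C := hC.to_subtype
  obtain ⟨φ, hφm, hφ⟩ := exists_measurable_nearest hC
  set g : (Σ n, Fin n → Fin K × C) → JumpPath (Fin d → ℝ) := fun w =>
    stepPath (fun i => gridPoint (w.2 i).1) (fun i => (w.2 i).2) with hgdef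
  set c : ℕ → Ω → Fin K × C := fun i ω =>
    (gridIndex K ((∑ j ∈ Finset.range (i + 1), e j ω) / lam), φ (Z i ω)) with hcdef
  set Y : Ω → JumpPath (Fin d → ℝ) := fun ω =>
    g ⟨countJumps lam (fun j => e j ω) 1, fun i => c i ω⟩ with hY
  have he := h.measurable_e
  have hN := h.measurableSet_countJumps_eq 1
  have hc : ∀ i x, MeasurableSet (c i ⁻¹' {x}) := by
    rintro i ⟨k, a⟩
    have : c i ⁻¹' {(k, a)} =
        (fun ω => gridIndex K ((∑ j ∈ Finset.range (i + 1), e j ω) / lam)) ⁻¹' {k} ∩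
          Z i ⁻¹' (φ ⁻¹' {a}) := by
      ext ω
      simp [hcdef]
    rw [this]
    refine MeasurableSet.inter ?_ (h.measurable_Z i (hφm a))
    exact (measurable_gridIndex K).comp (by fun_prop) (measurableSet_singleton k)
  have hYm : Measurable Y := by
    let _ : MeasurableSpace (Σ n, Fin n → Fin K × C) := ⊤
    exact (measurable_from_top (f := g)).comp
      (measurable_to_countable' (measurableSet_preimage_sigma_mk hN hc))
  have hent := discreteEntropy_comp_sigma_le hN hc g h.lam_pos.le
    (lintegral_countJumps_le h.measurable_e h.law_e h.indep_e h.lam_pos.le)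
  have hcard : ((Fintype.card (Fin K × C) : ℕ) : ℝ) = K * C.card := by simp
  rw [hcard] at hent
  have hKC : (1 : ℝ) ≤ K * C.card := by
    exact_mod_cast Nat.one_le_iff_ne_zero.2 (mul_ne_zero (NeZero.ne K) hC.card_pos.ne')
  have hlog0 := Real.log_nonneg hKC
  have hlam := h.lam_pos
  have hr0 : 0 ≤ r := le_trans (by positivity) hr
  have hYr : ((discreteEntropy P Y : ℝ≥0∞) : EReal) ≤ (r : EReal) := by
    refine (EReal.coe_ennreal_le_coe_ennreal_iff.2
      (hent.trans (ENNReal.ofReal_le_ofReal hr))).trans ?_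
    rw [EReal.coe_ennreal_ofReal, max_eq_left hr0]
  refine (iInf₂_le Y ⟨hYm, hYr⟩).trans ?_
  gcongr
  rw [← tsum_ofReal_pow_div_factorial hlam.le, ← ENNReal.tsum_mul_right]
  refine h.lintegral_rpow_le_tsum hs (f := fun _ => letterDistortion K C)
    (fun _ => measurable_letterDistortion K C) ?_
  filter_upwards [h.ae_pathDistortion_le] with ω hω n hn
  subst hn
  refine (hω K _ rfl _).trans ?_
  rw [Finset.sum_range]
  exact Finset.sum_le_sum fun i _ => add_le_add le_rfl (hφ _)

end IsCompoundPoisson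

theorem exists_entropyError_le_exp {lam : ℝ} (hlam : 0 < lam) :
    ∃ r₀ : ℝ, ∀ s : ℝ, 0 < s → ∀ M : ℝ≥0∞, ∃ C : ℝ, 0 < C ∧
      ∀ (d : ℕ) (Ω : Type*) [MeasurableSpace Ω] (P : Measure Ω) [IsProbabilityMeasure P]
        (e : ℕ → Ω → ℝ) (Z : ℕ → Ω → (Fin d → ℝ)) (X : Ω → JumpPath (Fin d → ℝ)),
      IsCompoundPoisson P lam e Z X →
      ∫⁻ ω, ENNReal.ofReal ‖Z 0 ω‖ ^ s ∂P = M →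
      (∀ ε : ℝ, 0 < ε → quantNumber P (Z 0) (supDist d) s ε < ⊤) →
      ∀ r : ℝ, r₀ ≤ r →
        entropyError P X (pathDistortion (supDist d)) s
            (lam * r + (lam + 1) *
              Real.log ((quantNumber P (Z 0) (supDist d) s (Real.exp (-r))).toNat : ℝ))
          ≤ ENNReal.ofReal (C * Real.exp (-r)) := by
  -- Chosen so that `lam * b = log 2 + lam * log 2`: lowering `log K` from `r` to `r - b` absorbs
  -- the additive constants of the entropy bound. As `r₀`, it ensures `K ≥ 1`.
  set b : ℝ := Real.log 2 + Real.log 2 / lam with hb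
  refine ⟨b, fun s hs M => ?_⟩
  -- If `M = ⊤` then `M.toReal = 0`, which is harmless: finite quantization numbers exclude this
  -- case.
  set B : ℝ := Real.exp (lam * Real.exp (s + 1)) *
    (2 ^ s * ((2 * Real.exp b) ^ s * M.toReal + 2 ^ s)) with hB
  have hB0 : 0 < B := by
    have := ENNReal.toReal_nonneg (a := M)
    positivity
  refine ⟨B ^ (1 / s), by positivity, ?_⟩
  intro d Ω _ P _ e Z X h hM hfin r hr
  obtain ⟨C, hC, hcard, hQ⟩ := exists_codebook_of_quantNumber_lt_top hs (Real.exp_pos (-r))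
    (hfin _ (Real.exp_pos (-r)))
  set D := (quantNumber P (Z 0) (supDist d) s (Real.exp (-r))).toNat
  have hMtop : M ≠ ⊤ := by
    rw [← hM]
    exact (lintegral_norm_rpow_lt_top hs hC (hQ.trans_lt (by finiteness))).ne
  have hx1 : 1 ≤ Real.exp (r - b) := Real.one_le_exp (by linarith)
  have hfl1 : 1 ≤ ⌊Real.exp (r - b)⌋₊ := Nat.le_floor (by simpa using hx1)
  set K := ⌊Real.exp (r - b)⌋₊ with hK
  have : NeZero K := ⟨by omega⟩
  have hK1 : (1 : ℝ) ≤ K := by exact_mod_cast hfl1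
  have hKle : (K : ℝ) ≤ Real.exp (r - b) := Nat.floor_le (by positivity)
  have hKlt : Real.exp (r - b) < K + 1 := Nat.lt_floor_add_one _
  have hC1 : (1 : ℝ) ≤ C.card := by exact_mod_cast hC.card_pos
  have hCD : (C.card : ℝ) ≤ D := by exact_mod_cast hcard
  have hrate : Real.log 2 + lam * (Real.log 2 + Real.log (K * C.card)) ≤
      lam * r + (lam + 1) * Real.log D := by
    have h1 : Real.log K ≤ r - b := by
      rw [← Real.log_exp (r - b)]
      exact Real.log_le_log (by linarith) hKle
    have h2 : Real.log C.card ≤ Real.log D := Real.log_le_log (by linarith) hCD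
    have h3 : 0 ≤ Real.log D := Real.log_nonneg (by linarith)
    rw [Real.log_mul (by linarith) (by linarith)]
    have h4 : lam * (Real.log 2 + (Real.log K + Real.log C.card)) ≤
        lam * (Real.log 2 + (r - b + Real.log D)) := by gcongr
    have h5 : lam * b = lam * Real.log 2 + Real.log 2 := by rw [hb]; field_simp
    nlinarith
  refine (h.entropyError_le hs K hC hrate).trans ?_
  -- Rounding a number at least `1` down loses at most a factor `2`.
  have hKinv : 1 / (K : ℝ) ≤ 2 * Real.exp b * Real.exp (-r) := by
    rw [div_le_iff₀ (by linarith)]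
    have : Real.exp b * Real.exp (-r) * Real.exp (r - b) = 1 := by
      rw [← Real.exp_add, ← Real.exp_add, show b + -r + (r - b) = 0 by ring, Real.exp_zero]
    have h2 : 0 < Real.exp b * Real.exp (-r) := by positivity
    nlinarith
  have hint := lintegral_letterDistortion_rpow_le (P := P) (h.measurable_Z 0) hs K C
  have hE : 0 < Real.exp (-r) := Real.exp_pos _
  have hbound : ENNReal.ofReal (Real.exp (lam * Real.exp (s + 1))) *
      ∫⁻ ω, letterDistortion K C (Z 0 ω) ^ s ∂P ≤ ENNReal.ofReal (B * Real.exp (-r) ^ s) := by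
    have h2 : (2 : ℝ≥0∞) ^ s = ENNReal.ofReal (2 ^ s) := by
      rw [← ENNReal.ofReal_rpow_of_pos two_pos]
      simp
    calc _ ≤ ENNReal.ofReal (Real.exp (lam * Real.exp (s + 1))) * (2 ^ s *
          (ENNReal.ofReal (2 * Real.exp b * Real.exp (-r)) ^ s * M +
            ENNReal.ofReal (2 * Real.exp (-r)) ^ s)) := by
          gcongr
          refine hint.trans ?_
          rw [hM]
          gcongr
      _ = _ := by
          rw [← ENNReal.ofReal_toReal hMtop, h2, ENNReal.ofReal_rpow_of_pos (by positivity),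
            ENNReal.ofReal_rpow_of_pos (by positivity), ← ENNReal.ofReal_mul (by positivity),
            ← ENNReal.ofReal_add (by positivity) (by positivity),
            ← ENNReal.ofReal_mul (by positivity), ← ENNReal.ofReal_mul (by positivity), hB,
            Real.mul_rpow (by positivity) hE.le, Real.mul_rpow two_pos.le hE.le]
          congr 1
          ring
  calc _ ≤ ENNReal.ofReal (B * Real.exp (-r) ^ s) ^ (1 / s) := by gcongr
    _ = _ := by
      rw [ENNReal.ofReal_rpow_of_pos (by positivity), Real.mul_rpow hB0.le (by positivity),
        ← Real.rpow_mul hE.le, mul_one_div_cancel hs.ne', Real.rpow_one]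

/-! ### Quantization -/

namespace IsCompoundPoisson

variable {Ω : Type*} [MeasurableSpace Ω] {P : Measure Ω} [IsProbabilityMeasure P] {d : ℕ} {lam : ℝ}
  {e : ℕ → Ω → ℝ} {Z : ℕ → Ω → (Fin d → ℝ)} {X : Ω → JumpPath (Fin d → ℝ)}

/-- The codebook is the union over `n ≤ m` of all grid paths with `n` coded jumps. For `n > m` the
letter codebook is `{0}`, so every such path is coded by the zero path, whatever its jump times, and
needs no further codeword. -/
theorem quantError_le_tsum (h : IsCompoundPoisson P lam e Z X) {s : ℝ} (hs : 0 < s) (m : ℕ)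
    (K : ℕ → ℕ) (hK : ∀ n, K n ≠ 0) (C : ℕ → Finset (Fin d → ℝ)) (hC : ∀ n, (C n).Nonempty)
    (hCm : ∀ n, m < n → C n = {0}) {r : ℝ}
    (hr : Real.log (∑ n ∈ Finset.range (m + 1), ((K n : ℝ) * (C n).card) ^ n) ≤ r) :
    quantError P X (pathDistortion (supDist d)) s r ≤
      (∑' n : ℕ, ENNReal.ofReal (lam ^ n / n.factorial) * ENNReal.ofReal (Real.exp ((s + 1) * n)) *
        ∫⁻ ω, letterDistortion (K n) (C n) (Z 0 ω) ^ s ∂P) ^ (1 / s) := by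
  classical
  have hKz : ∀ n, NeZero (K n) := fun n => ⟨hK n⟩
  set path : ∀ n, (Fin n → Fin (K n) × C n) → JumpPath (Fin d → ℝ) := fun n a =>
    stepPath (fun i => gridPoint (a i).1) (fun i => (a i).2)
  set B : Finset (JumpPath (Fin d → ℝ)) :=
    (Finset.range (m + 1)).biUnion fun n => Finset.univ.image (path n) with hB
  have hmem : ∀ n ≤ m, ∀ a, path n a ∈ B := fun n hn a =>
    Finset.mem_biUnion.2 ⟨n, by simpa [Nat.lt_succ_iff] using hn,
      Finset.mem_image_of_mem _ (Finset.mem_univ a)⟩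
  have hzero : stepPath (n := 0) Fin.elim0 Fin.elim0 ∈ B := by
    have := hmem 0 (Nat.zero_le m) Fin.elim0
    convert this
  have hne : B.Nonempty := ⟨_, hzero⟩
  have hcard : (B.card : ℝ) ≤ ∑ n ∈ Finset.range (m + 1), ((K n : ℝ) * (C n).card) ^ n := by
    have h1 : B.card ≤ ∑ n ∈ Finset.range (m + 1), (K n * (C n).card) ^ n := by
      refine Finset.card_biUnion_le.trans (Finset.sum_le_sum fun n _ => ?_)
      refine Finset.card_image_le.trans_eq ?_
      simp
    exact_mod_cast h1
  refine (iInf₂_le B ⟨hne, (Real.log_le_log (by exact_mod_cast hne.card_pos) hcard).trans hr⟩).trans ?_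
  gcongr
  refine h.lintegral_rpow_le_tsum hs (f := fun n => letterDistortion (K n) (C n))
    (fun n => measurable_letterDistortion (K n) (C n)) ?_
  filter_upwards [h.ae_pathDistortion_le] with ω hω n hn
  choose c hcmem hcmin using fun i : Fin n =>
    (C n).exists_min_image (fun a => supDist d (Z i ω) a) (hC n)
  have hcB : stepPath (fun i : Fin n => gridPoint (gridIndex (K n)
      ((∑ j ∈ Finset.range (i + 1), e j ω) / lam))) c ∈ B := by
    rcases le_or_gt n m with hnm | hnm
    · exact hmem n hnm fun i =>
        (gridIndex (K n) ((∑ j ∈ Finset.range (i + 1), e j ω) / lam), ⟨c i, hcmem i⟩)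
    · have hc0 : c = fun _ => 0 := by
        ext1 i
        have := hcmem i
        rwa [hCm n hnm, Finset.mem_singleton] at this
      rw [hc0, stepPath_zero_eq]
      exact hzero
  refine (iInf₂_le _ hcB).trans ((hω (K n) n hn c).trans ?_)
  rw [Finset.sum_range]
  exact Finset.sum_le_sum fun i _ => add_le_add le_rfl (le_iInf₂ (hcmin i))

/-- The precision `exp (-l n)` decreases linearly in the exponent with `n`, trading the size of the
`n`-th codebook against the probability of `n` jumps. The parameter `a` is the slope of this
trade-off; `m` is large enough that `l n = 0` beyond it. -/
theorem quantError_le_of_codebooks (h : IsCompoundPoisson P lam e Z X) {s : ℝ} (hs : 0 < s)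
    {M : ℝ≥0∞} (hM : ∫⁻ ω, ENNReal.ofReal ‖Z 0 ω‖ ^ s ∂P = M) {g A : ℝ} (hg : 0 ≤ 1 + g)
    (hA : 0 ≤ A) (hQ : ∀ δ : ℝ, 0 < δ → δ ≤ 1 → ∃ C : Finset (Fin d → ℝ), C.Nonempty ∧
      Real.log C.card ≤ g * Real.log (1 / δ) + A ∧
      ∫⁻ ω, (⨅ a ∈ C, supDist d (Z 0 ω) a) ^ s ∂P ≤ ENNReal.ofReal (2 * δ) ^ s)
    {R a : ℝ} (ha : 0 < a) {m : ℕ} (hm : s * R ≤ a * m) :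
    quantError P X (pathDistortion (supDist d)) s
      (Real.log (m + 1) + ((1 + g) * (s * R ^ 2 / (4 * a)) + m * (Real.log 2 + A))) ≤
      (ENNReal.ofReal (Real.exp (lam * Real.exp (s + 1 + a))) *
        (ENNReal.ofReal (Real.exp (-(s * R))) * (2 ^ s * (M + (M + 2 ^ s))))) ^ (1 / s) := by
  set l : ℕ → ℝ := fun n => max (R - a * n / s) 0 with hl
  have hl0 : ∀ n, 0 ≤ l n := fun n => le_max_right _ _
  have hlm : ∀ n, m < n → l n = 0 := by
    intro n hn
    refine max_eq_right ?_
    have hn' : (m : ℝ) ≤ n := by exact_mod_cast hn.le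
    have : a * m ≤ a * n := by gcongr
    rw [sub_nonpos, le_div_iff₀ hs]
    linarith
  have hln : ∀ n : ℕ, n * l n ≤ s * R ^ 2 / (4 * a) := by
    intro n
    rw [le_div_iff₀ (by positivity)]
    rcases le_total (R - a * n / s) 0 with h0 | h0
    · simp only [hl, max_eq_right h0, mul_zero, zero_mul]
      positivity
    -- Completing the square: `n (R - a n / s)` is largest at `n = s R / (2a)`.
    · simp only [hl, max_eq_left h0]
      have h1 : n * (R - a * n / s) * (4 * a) = s * (R ^ 2 - (R - 2 * (a * n / s)) ^ 2) := by
        field_simp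
        ring
      rw [h1]
      gcongr
      linarith [sq_nonneg (R - 2 * (a * n / s))]
  have hδ : ∀ n, ∃ C : Finset (Fin d → ℝ), C.Nonempty ∧ (m < n → C = {0}) ∧
      (n ≤ m → Real.log C.card ≤ g * l n + A) ∧
      ∫⁻ ω, (⨅ a ∈ C, supDist d (Z 0 ω) a) ^ s ∂P ≤
        ENNReal.ofReal (Real.exp (-l n)) ^ s * (M + 2 ^ s) := by
    intro n
    rcases le_or_gt n m with hn | hn
    · obtain ⟨C, h1, h2, h3⟩ := hQ (Real.exp (-l n)) (Real.exp_pos _)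
        (Real.exp_le_one_iff.2 (by linarith [hl0 n]))
      refine ⟨C, h1, fun h => absurd h (not_lt.2 hn), fun _ => ?_, h3.trans ?_⟩
      · simpa using h2
      · rw [ENNReal.ofReal_mul two_pos.le, ENNReal.mul_rpow_of_nonneg _ _ hs.le, mul_comm]
        gcongr
        simp
    · refine ⟨{0}, by simp, fun _ => rfl, fun h => absurd hn (not_lt.2 h), ?_⟩
      simpa [hlm n hn, supDist] using hM.le.trans le_self_add
  choose C hC hCm hCcard hCint using hδ
  set K : ℕ → ℕ := fun n => ⌈Real.exp (l n)⌉₊ with hK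
  have hKge : ∀ n, Real.exp (l n) ≤ K n := fun n => Nat.le_ceil _
  have hKpos : ∀ n, (0 : ℝ) < K n := fun n => (Real.exp_pos _).trans_le (hKge n)
  have hKle : ∀ n, (K n : ℝ) ≤ 2 * Real.exp (l n) := by
    intro n
    have h1 := Nat.ceil_lt_add_one (Real.exp_pos (l n)).le
    have h2 := Real.one_le_exp (hl0 n)
    simp only [hK]
    linarith
  have hcount : ∀ n ≤ m, ((K n : ℝ) * (C n).card) ^ n ≤
      Real.exp ((1 + g) * (s * R ^ 2 / (4 * a)) + m * (Real.log 2 + A)) := by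
    intro n hn
    have hC0 : (0 : ℝ) < (C n).card := by exact_mod_cast (hC n).card_pos
    have hCexp : ((C n).card : ℝ) ≤ Real.exp (g * l n + A) :=
      (Real.log_le_iff_le_exp hC0).1 (hCcard n hn)
    have hl2 := Real.log_nonneg one_le_two
    calc ((K n : ℝ) * (C n).card) ^ n
        ≤ (2 * Real.exp (l n) * Real.exp (g * l n + A)) ^ n := by
          gcongr
          exact hKle n
      _ = Real.exp ((1 + g) * (n * l n) + n * (Real.log 2 + A)) := by
          nth_rewrite 1 [← Real.exp_log two_pos]
          rw [← Real.exp_add, ← Real.exp_add, ← Real.exp_nat_mul]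
          ring_nf
      _ ≤ _ := by
          have hn' : (n : ℝ) ≤ m := by exact_mod_cast hn
          gcongr
          exact hln n
  refine (h.quantError_le_tsum hs m K (fun n => by exact_mod_cast (hKpos n).ne') C hC hCm ?_).trans ?_
  · calc Real.log (∑ n ∈ Finset.range (m + 1), ((K n : ℝ) * (C n).card) ^ n)
        ≤ Real.log ((m + 1) * Real.exp ((1 + g) * (s * R ^ 2 / (4 * a)) + m * (Real.log 2 + A))) := by
          refine Real.log_le_log ?_ ?_
          · refine Finset.sum_pos (fun n _ => pow_pos (mul_pos (hKpos n) ?_) n) (by simp)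
            exact_mod_cast (hC n).card_pos
          · refine (Finset.sum_le_card_nsmul _ _ _ fun n hn => hcount n ?_).trans_eq (by simp)
            simpa [Nat.lt_succ_iff] using hn
      _ = _ := by rw [Real.log_mul (by positivity) (Real.exp_pos _).ne', Real.log_exp]
  · gcongr
    rw [← tsum_ofReal_pow_div_factorial h.lam_pos.le, ← ENNReal.tsum_mul_right]
    refine ENNReal.tsum_le_tsum fun n => ?_
    have h1 : ∫⁻ ω, letterDistortion (K n) (C n) (Z 0 ω) ^ s ∂P ≤
        ENNReal.ofReal (Real.exp (-l n)) ^ s * (2 ^ s * (M + (M + 2 ^ s))) := by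
      refine (lintegral_letterDistortion_rpow_le (h.measurable_Z 0) hs (K n) (C n)).trans ?_
      rw [hM, mul_left_comm, mul_add (ENNReal.ofReal (Real.exp (-l n)) ^ s)]
      have : 1 / (K n : ℝ) ≤ Real.exp (-l n) := by
        rw [Real.exp_neg, ← one_div]
        exact one_div_le_one_div_of_le (Real.exp_pos _) (hKge n)
      gcongr
      exact hCint n
    -- Since `l n ≥ R - a n / s` for every `n`, the letter error yields `exp (-sR)` at the price of
    -- a weight `exp (a n)`, absorbed by the exponential series.
    have h2 : ENNReal.ofReal (Real.exp (-l n)) ^ s ≤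
        ENNReal.ofReal (Real.exp (a * n)) * ENNReal.ofReal (Real.exp (-(s * R))) := by
      rw [ENNReal.ofReal_rpow_of_pos (Real.exp_pos _), ← Real.exp_mul,
        ← ENNReal.ofReal_mul (Real.exp_pos _).le, ← Real.exp_add]
      refine ENNReal.ofReal_le_ofReal (Real.exp_le_exp.2 ?_)
      have h3 : (R - a * n / s) * s ≤ l n * s := by
        gcongr
        exact le_max_left _ _
      have h4 : (R - a * n / s) * s = R * s - a * n := by field_simp
      linarith
    have h3 : ENNReal.ofReal (Real.exp ((s + 1 + a) * n)) =
        ENNReal.ofReal (Real.exp ((s + 1) * n)) * ENNReal.ofReal (Real.exp (a * n)) := by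
      rw [← ENNReal.ofReal_mul (Real.exp_pos _).le, ← Real.exp_add, ← add_mul]
    calc _ ≤ ENNReal.ofReal (lam ^ n / n.factorial) * ENNReal.ofReal (Real.exp ((s + 1) * n)) *
          (ENNReal.ofReal (Real.exp (a * n)) * ENNReal.ofReal (Real.exp (-(s * R))) *
            (2 ^ s * (M + (M + 2 ^ s)))) := by
          gcongr
          exact h1.trans (by gcongr)
      _ = _ := by
          rw [h3]
          ring

end IsCompoundPoisson

/-! ### Codebooks from the growth exponent of the quantization number -/

section
variable {Ω E : Type*} [MeasurableSpace Ω] {P : Measure Ω} {X : Ω → E} {ρ : E → E → ℝ≥0∞} {s : ℝ}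

theorem quantError_antitone : Antitone (quantError P X ρ s) := fun _ _ h =>
  le_iInf₂ fun C hC => iInf₂_le C ⟨hC.1, hC.2.trans h⟩

theorem one_le_quantNumber (ε : ℝ) : 1 ≤ quantNumber P X ρ s ε :=
  le_iInf₂ fun n hn => by exact_mod_cast hn.1

theorem limsup_log_quantNumber_nonneg {γ : ℝ} (hγ : limsup (fun ε : ℝ =>
    ENNReal.log ((quantNumber P X ρ s ε : ℕ∞) : ℝ≥0∞) / ((Real.log (1 / ε) : ℝ) : EReal))
      (𝓝[>] 0) = (γ : EReal)) : 0 ≤ γ := by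
  have h : ∀ᶠ ε in 𝓝[>] (0 : ℝ), (0 : EReal) ≤
      ENNReal.log ((quantNumber P X ρ s ε : ℕ∞) : ℝ≥0∞) / ((Real.log (1 / ε) : ℝ) : EReal) := by
    filter_upwards [Ioo_mem_nhdsGT (zero_lt_one (α := ℝ))] with ε hε
    refine EReal.div_nonneg ?_ ?_
    · rw [ENNReal.zero_le_log_iff]
      exact_mod_cast one_le_quantNumber (P := P) (X := X) (ρ := ρ) (s := s) ε
    · rw [one_div, Real.log_inv]
      exact_mod_cast neg_nonneg.2 (Real.log_nonpos hε.1.le hε.2.le)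
  have h0 : (0 : EReal) ≤ γ := hγ ▸ le_limsup_of_frequently_le h.frequently
  exact_mod_cast h0

/-- The limsup controls only small precisions. Rescaling `δ ≤ 1` by the fixed factor `ε₁ / 2` moves
it into that range and costs the additive constant `A`. -/
theorem exists_codebooks_of_limsup_lt (hs : 0 < s) {γ g : ℝ} (hg : γ < g) (hg0 : 0 ≤ g)
    (hγ : limsup (fun ε : ℝ => ENNReal.log ((quantNumber P X ρ s ε : ℕ∞) : ℝ≥0∞) /
      ((Real.log (1 / ε) : ℝ) : EReal)) (𝓝[>] 0) = (γ : EReal)) :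
    ∃ A : ℝ, 0 ≤ A ∧ ∀ δ : ℝ, 0 < δ → δ ≤ 1 → ∃ C : Finset E, C.Nonempty ∧
      Real.log C.card ≤ g * Real.log (1 / δ) + A ∧
      ∫⁻ ω, (⨅ a ∈ C, ρ (X ω) a) ^ s ∂P ≤ ENNReal.ofReal (2 * δ) ^ s := by
  have hev := eventually_lt_of_limsup_lt (hγ.trans_lt (EReal.coe_lt_coe_iff.2 hg))
  obtain ⟨ε₁, ⟨h0, h1⟩, hsub⟩ :=
    (mem_nhdsGT_iff_exists_mem_Ioc_Ioo_subset (zero_lt_one (α := ℝ))).1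
      (inter_mem hev (Ioo_mem_nhdsGT (zero_lt_one (α := ℝ))))
  have hl0 : 0 ≤ Real.log (1 / (ε₁ / 2)) := Real.log_nonneg (by
    rw [le_div_iff₀ (by linarith)]; linarith)
  refine ⟨g * Real.log (1 / (ε₁ / 2)), mul_nonneg hg0 hl0, fun δ hδ hδ1 => ?_⟩
  have hε : 0 < δ * (ε₁ / 2) := by positivity
  obtain ⟨hlt, hε1⟩ := hsub (show δ * (ε₁ / 2) ∈ Set.Ioo 0 ε₁ from ⟨hε, by nlinarith⟩)
  set ε := δ * (ε₁ / 2) with hεdef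
  have hlogε : 0 < Real.log (1 / ε) := Real.log_pos (by
    rw [lt_div_iff₀ hε]; linarith [hε1.2])
  simp only [Set.mem_ofPred_eq] at hlt
  rw [EReal.div_lt_iff (by exact_mod_cast hlogε) (EReal.coe_ne_top _), ← EReal.coe_mul] at hlt
  have hfin : quantNumber P X ρ s ε < ⊤ := by
    refine lt_top_iff_ne_top.2 fun htop => ?_
    rw [htop] at hlt
    simp at hlt
  obtain ⟨C, hC, hcard, hint⟩ := exists_codebook_of_quantNumber_lt_top hs hε hfin
  have hcoe := ENat.natCast_toNat hfin.ne
  set n := (quantNumber P X ρ s ε).toNat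
  have hc0 : (0 : ℝ) < C.card := by exact_mod_cast hC.card_pos
  have hcn : (C.card : ℝ) ≤ n := by exact_mod_cast hcard
  have hlogn : Real.log n < g * Real.log (1 / ε) := by
    rw [← hcoe] at hlt
    have : (((n : ℕ∞) : ℝ≥0∞)) = ENNReal.ofReal n := by simp
    rw [this, ENNReal.log_ofReal_of_pos (hc0.trans_le hcn)] at hlt
    exact_mod_cast hlt
  refine ⟨C, hC, ?_, hint.trans ?_⟩
  · have : Real.log (1 / ε) = Real.log (1 / δ) + Real.log (1 / (ε₁ / 2)) := by
      rw [← Real.log_mul (by positivity) (by positivity), hεdef]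
      congr 1
      field_simp
    rw [← mul_add, ← this]
    exact (Real.log_le_log hc0 hcn).trans hlogn.le
  · gcongr
    nlinarith

end

/-! ### Asymptotics of `R = θ² √(κ r log r)` -/

section
variable {θ κ : ℝ}

theorem rpow_le_sq_sqrt_mul_log (h0 : 0 < θ) (h1 : θ < 1) (hκ : 0 < κ) :
    ∀ᶠ r : ℝ in atTop, r ^ (θ / 2) ≤ θ ^ 2 * √(κ * (r * Real.log r)) := by
  filter_upwards [Real.tendsto_log_atTop.eventually_ge_atTop (1 / (θ ^ 4 * κ)),
    eventually_ge_atTop (1 : ℝ)] with r hr hr1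
  have hlog : 0 ≤ Real.log r := Real.log_nonneg hr1
  refine (sq_le_sq₀ (by positivity) (by positivity)).1 ?_
  rw [mul_pow, Real.sq_sqrt (by positivity), ← Real.rpow_natCast, ← Real.rpow_mul (by linarith)]
  have h2 : 1 ≤ θ ^ 4 * κ * Real.log r := by
    rw [div_le_iff₀ (by positivity)] at hr
    linarith
  calc r ^ (θ / 2 * (2 : ℕ)) ≤ r ^ (1 : ℝ) := by
        refine Real.rpow_le_rpow_of_exponent_le hr1 ?_
        push_cast
        linarith
    _ = r * 1 := by rw [Real.rpow_one, mul_one]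
    _ ≤ r * (θ ^ 4 * κ * Real.log r) := by gcongr
    _ = _ := by ring

theorem tendsto_sq_sqrt_mul_log (h0 : 0 < θ) (h1 : θ < 1) (hκ : 0 < κ) :
    Tendsto (fun r : ℝ => θ ^ 2 * √(κ * (r * Real.log r))) atTop atTop :=
  tendsto_atTop_mono' _ (rpow_le_sq_sqrt_mul_log h0 h1 hκ) (tendsto_rpow_atTop (by positivity))

theorem sq_sqrt_mul_log_le_mul (hκ : 0 < κ) {η : ℝ} (hη : 0 < η) :
    ∀ᶠ r : ℝ in atTop, θ ^ 2 * √(κ * (r * Real.log r)) ≤ η * r := by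
  have hc : 0 < η ^ 2 / (θ ^ 4 * κ + 1) := by positivity
  filter_upwards [Real.isLittleO_log_id_atTop.bound hc, eventually_ge_atTop (1 : ℝ)] with r hr hr1
  have hlog : 0 ≤ Real.log r := Real.log_nonneg hr1
  refine (sq_le_sq₀ (by positivity) (by positivity)).1 ?_
  rw [mul_pow, Real.sq_sqrt (by positivity)]
  rw [Real.norm_of_nonneg hlog, id, Real.norm_of_nonneg (by linarith), div_mul_eq_mul_div,
    le_div_iff₀ (by positivity)] at hr
  have h2 : (θ ^ 4 * κ) * Real.log r ≤ η ^ 2 * r := by nlinarith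
  calc (θ ^ 2) ^ 2 * (κ * (r * Real.log r)) = r * ((θ ^ 4 * κ) * Real.log r) := by ring
    _ ≤ r * (η ^ 2 * r) := by gcongr
    _ = _ := by ring

/-- Since `R ≥ r^(θ/2)`, `log R` is at least `(θ/2) log r`, which cancels the logarithm in `R²`. -/
theorem sq_div_log_le_mul (h0 : 0 < θ) (h1 : θ < 1) (hκ : 0 < κ) :
    ∀ᶠ r : ℝ in atTop, (θ ^ 2 * √(κ * (r * Real.log r))) ^ 2 /
      Real.log (θ ^ 2 * √(κ * (r * Real.log r))) ≤ 2 * θ ^ 3 * κ * r := by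
  filter_upwards [rpow_le_sq_sqrt_mul_log h0 h1 hκ, eventually_gt_atTop (1 : ℝ)] with r hr hr1
  have hlog : 0 < Real.log r := Real.log_pos hr1
  have hr0 : 0 < r := by linarith
  have h2 := Real.log_le_log (by positivity) hr
  rw [Real.log_rpow hr0] at h2
  rw [div_le_iff₀ (lt_of_lt_of_le (by positivity) h2), mul_pow, Real.sq_sqrt (by positivity)]
  calc (θ ^ 2) ^ 2 * (κ * (r * Real.log r)) = 2 * θ ^ 3 * κ * r * (θ / 2 * Real.log r) := by ring
    _ ≤ _ := by gcongr

theorem mul_rpow_add_le_mul (h1 : θ < 1) (a b : ℝ) {c : ℝ} (hc : 0 < c) :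
    ∀ᶠ R : ℝ in atTop, a * R ^ θ + b ≤ c * R := by
  have h := (tendsto_rpow_neg_atTop (y := 1 - θ) (by linarith)).const_mul a
  have h' := (tendsto_inv_atTop_zero (𝕜 := ℝ)).const_mul b
  have hsum := h.add h'
  simp only [mul_zero, add_zero] at hsum
  filter_upwards [hsum.eventually_le_const hc, eventually_gt_atTop (0 : ℝ)] with R hR hR0
  have h3 : R ^ (-(1 - θ)) * R = R ^ θ := by
    rw [← Real.rpow_add_one hR0.ne']
    congr 1
    ring
  calc a * R ^ θ + b = (a * R ^ (-(1 - θ)) + b * R⁻¹) * R := by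
        rw [← h3]
        field_simp
    _ ≤ c * R := by gcongr

end

theorem EReal.le_of_forall_mul_lt_one {x : EReal}
    (h : ∀ θ : ℝ, 0 < θ → θ < 1 → ((θ ^ 3 : ℝ) : EReal) ≤ x) : 1 ≤ x := by
  have hlim : Tendsto (fun θ : ℝ => ((θ ^ 3 : ℝ) : EReal)) (𝓝[<] 1) (𝓝 1) := by
    have : Tendsto (fun θ : ℝ => θ ^ 3) (𝓝[<] 1) (𝓝 (1 ^ 3)) :=
      ((continuous_pow 3).tendsto (1 : ℝ)).mono_left nhdsWithin_le_nhds
    rw [one_pow] at this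
    exact (continuous_coe_real_ereal.tendsto (1 : ℝ)).comp this
  refine le_of_tendsto hlim ?_
  filter_upwards [Ioo_mem_nhdsLT (zero_lt_one (α := ℝ))] with θ hθ
  exact h θ hθ.1 hθ.2

/-! ### Choice of parameters for the quantization rate -/

namespace IsCompoundPoisson

variable {Ω : Type*} [MeasurableSpace Ω] {P : Measure Ω} [IsProbabilityMeasure P] {d : ℕ} {lam : ℝ}
  {e : ℕ → Ω → ℝ} {Z : ℕ → Ω → (Fin d → ℝ)} {X : Ω → JumpPath (Fin d → ℝ)}

theorem eventually_quantError_le (h : IsCompoundPoisson P lam e Z X) {s : ℝ} (hs : 0 < s) {γ : ℝ}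
    (hγ : limsup (fun ε : ℝ => ENNReal.log ((quantNumber P (Z 0) (supDist d) s ε : ℕ∞) : ℝ≥0∞) /
      ((Real.log (1 / ε) : ℝ) : EReal)) (𝓝[>] 0) = (γ : EReal)) {θ : ℝ} (h0 : 0 < θ) (h1 : θ < 1) :
    ∀ᶠ r in atTop, quantError P X (pathDistortion (supDist d)) s r ≤
      ENNReal.ofReal (Real.exp (-(θ ^ 3 * √(2 / (s * (1 + γ)) * (r * Real.log r))))) := by
  have hγ0 := limsup_log_quantNumber_nonneg hγ
  set κ : ℝ := 2 / (s * (1 + γ)) with hκdef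
  have hκ : 0 < κ := by positivity
  -- An exponent slightly above `γ`, with `1 + g = (1 + γ) / θ`; positivity of `1 + γ` comes from `γ
  -- ≥ 0`.
  set g : ℝ := (1 + γ) / θ - 1 with hgdef
  have hγg : γ < g := by
    have : 1 + γ < (1 + γ) / θ := by
      rw [lt_div_iff₀ h0]
      nlinarith
    linarith
  obtain ⟨A, hA, hQ⟩ := exists_codebooks_of_limsup_lt hs hγg (hγ0.trans hγg.le) hγ
  set M := ∫⁻ ω, ENNReal.ofReal ‖Z 0 ω‖ ^ s ∂P with hM
  have hMtop : M ≠ ⊤ := by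
    obtain ⟨C, hC, -, hint⟩ := hQ 1 one_pos le_rfl
    exact (lintegral_norm_rpow_lt_top hs hC (hint.trans_lt (by finiteness))).ne
  set B : ℝ≥0∞ := 2 ^ s * (M + (M + 2 ^ s)) with hB
  have hBtop : B ≠ ⊤ := by finiteness
  have hBexp : B ≤ ENNReal.ofReal (Real.exp B.toReal) := by
    rw [ENNReal.le_ofReal_iff_toReal_le hBtop (Real.exp_pos _).le]
    linarith [Real.add_one_le_exp B.toReal]
  -- Cost per unit of `m` of the lower-order terms in the rate; the summand `1` pays for `log (m +
  -- 1) ≤ m`.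
  set c₀ : ℝ := Real.log 2 + A + 1 with hc₀
  have hc₀pos : 0 < c₀ := by
    have := Real.log_nonneg one_le_two
    linarith
  have htend := tendsto_sq_sqrt_mul_log h0 h1 hκ
  filter_upwards [htend.eventually (mul_rpow_add_le_mul h1 (lam * Real.exp (s + 1)) B.toReal
      (c := s * (1 - θ)) (mul_pos hs (by linarith))),
    htend.eventually (Real.tendsto_log_atTop.eventually_ge_atTop (s / θ)),
    htend.eventually_gt_atTop 0, sq_div_log_le_mul h0 h1 hκ,
    sq_sqrt_mul_log_le_mul (θ := θ) hκ (η := (1 - θ) / (2 * c₀)) (div_pos (by linarith) (by positivity)),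
    eventually_ge_atTop (1 / ((1 - θ) / (2 * c₀)))] with r hr1 hr2 hR0 hr3 hr4 hr5
  set R : ℝ := θ ^ 2 * √(κ * (r * Real.log r)) with hR
  have hθ3 : θ ^ 3 * √(κ * (r * Real.log r)) = θ * R := by rw [hR]; ring
  have hlogR : 0 < Real.log R := lt_of_lt_of_le (by positivity) hr2
  set m := ⌈R⌉₊ with hm
  have hRm : R ≤ m := Nat.le_ceil R
  have hmR : (m : ℝ) < R + 1 := Nat.ceil_lt_add_one hR0.le
  have hsa : s ≤ θ * Real.log R := by
    rw [div_le_iff₀ h0] at hr2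
    linarith
  have hbound := h.quantError_le_of_codebooks hs hM.symm (by linarith) hA hQ
    (a := θ * Real.log R) (by positivity) (m := m) (R := R) (by gcongr)
  rw [hθ3]
  refine (quantError_antitone ?_).trans (hbound.trans ?_)
  -- The rate `r` is split: the main term uses `θ r`, and the terms linear in `m` fit into `(1 - θ)
  -- r` because `R` is sublinear in `r`.
  · have e1 : (1 + g) * (s * R ^ 2 / (4 * (θ * Real.log R))) ≤ θ * r := by
      have : (1 + g) * (s * R ^ 2 / (4 * (θ * Real.log R))) =
          (1 + γ) * s / (4 * θ ^ 2) * (R ^ 2 / Real.log R) := by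
        rw [hgdef]
        field_simp
        ring
      rw [this]
      calc (1 + γ) * s / (4 * θ ^ 2) * (R ^ 2 / Real.log R)
          ≤ (1 + γ) * s / (4 * θ ^ 2) * (2 * θ ^ 3 * κ * r) := by gcongr
        _ = θ * r := by
          rw [hκdef]
          field_simp
          ring
    have e2 : Real.log (m + 1) ≤ m := by
      have := Real.log_le_sub_one_of_pos (show (0 : ℝ) < m + 1 by positivity)
      linarith
    have e3 : m * c₀ ≤ (1 - θ) * r := by
      have hη : 0 < (1 - θ) / (2 * c₀) := div_pos (by linarith) (by positivity)
      have h6 : 1 ≤ (1 - θ) / (2 * c₀) * r := by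
        rwa [div_le_iff₀' hη] at hr5
      calc m * c₀ ≤ ((1 - θ) / (2 * c₀) * r + (1 - θ) / (2 * c₀) * r) * c₀ := by
            gcongr
            linarith
        _ = (1 - θ) * r := by
            field_simp
            ring
    have e4 : m * c₀ = m * (Real.log 2 + A) + m := by rw [hc₀]; ring
    linarith
  · have hexp : Real.exp (s + 1 + θ * Real.log R) = Real.exp (s + 1) * R ^ θ := by
      rw [Real.exp_add, Real.rpow_def_of_pos hR0, mul_comm θ]
    calc _ ≤ (ENNReal.ofReal (Real.exp (lam * Real.exp (s + 1 + θ * Real.log R))) *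
          (ENNReal.ofReal (Real.exp (-(s * R))) * ENNReal.ofReal (Real.exp B.toReal))) ^ (1 / s) := by
          gcongr
      -- The part `s (1 - θ) R` of the exponent `s R` absorbs `lam * exp (s + 1) * R ^ θ` and the
      -- constant.
      _ ≤ ENNReal.ofReal (Real.exp (-(θ * R) * s)) ^ (1 / s) := by
          gcongr
          rw [← ENNReal.ofReal_mul (Real.exp_pos _).le, ← ENNReal.ofReal_mul (Real.exp_pos _).le,
            ← Real.exp_add, ← Real.exp_add, hexp]
          refine ENNReal.ofReal_le_ofReal (Real.exp_le_exp.2 ?_)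
          nlinarith
      _ = _ := by
          rw [ENNReal.ofReal_rpow_of_pos (Real.exp_pos _), ← Real.exp_mul, mul_assoc,
            mul_one_div_cancel hs.ne', mul_one]

theorem one_le_liminf_log_quantError (h : IsCompoundPoisson P lam e Z X) {s : ℝ} (hs : 0 < s)
    {γ : ℝ} (hγ : limsup (fun ε : ℝ =>
      ENNReal.log ((quantNumber P (Z 0) (supDist d) s ε : ℕ∞) : ℝ≥0∞) /
        ((Real.log (1 / ε) : ℝ) : EReal)) (𝓝[>] 0) = (γ : EReal)) :
    1 ≤ liminf (fun r : ℝ => -ENNReal.log (quantError P X (pathDistortion (supDist d)) s r) /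
      ((Real.sqrt (2 / (s * (1 + γ)) * (r * Real.log r)) : ℝ) : EReal)) atTop := by
  have hγ0 := limsup_log_quantNumber_nonneg hγ
  refine EReal.le_of_forall_mul_lt_one fun θ h0 h1 => le_liminf_of_le (h := ?_)
  filter_upwards [h.eventually_quantError_le hs hγ h0 h1, eventually_gt_atTop (1 : ℝ)] with r hr hr1
  have hlog := Real.log_pos hr1
  have hq : 0 < √(2 / (s * (1 + γ)) * (r * Real.log r)) := by positivity
  rw [EReal.le_div_iff_mul_le (by exact_mod_cast hq) (EReal.coe_ne_top _), ← EReal.coe_mul,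
    EReal.le_neg, ← EReal.coe_neg]
  refine (ENNReal.log_le_log hr).trans_eq ?_
  rw [ENNReal.log_ofReal_of_pos (Real.exp_pos _), Real.log_exp]

end IsCompoundPoisson

theorem mainTheorem8 :
    -- (a)
    (∀ (d : ℕ) (Ω : Type*) [MeasurableSpace Ω] (P : Measure Ω) [IsProbabilityMeasure P]
        (lam : ℝ) (e : ℕ → Ω → ℝ) (Z : ℕ → Ω → (Fin d → ℝ)) (X : Ω → JumpPath (Fin d → ℝ)),
      IsCompoundPoisson P lam e Z X → ∀ s : ℝ, 0 < s → ∀ γ : ℝ,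
      limsup (fun ε : ℝ =>
          ENNReal.log ((quantNumber P (Z 0) (supDist d) s ε : ℕ∞) : ℝ≥0∞) /
            ((Real.log (1 / ε) : ℝ) : EReal)) (𝓝[>] 0) = (γ : EReal) →
      1 ≤ liminf (fun r : ℝ =>
          -ENNReal.log (quantError P X (pathDistortion (supDist d)) s r) /
            ((Real.sqrt (2 / (s * (1 + γ)) * (r * Real.log r)) : ℝ) : EReal)) atTop) ∧
    -- (b)
    (∀ lam : ℝ, 0 < lam → ∃ r₀ : ℝ, ∀ s : ℝ, 0 < s → ∀ M : ℝ≥0∞, ∃ C : ℝ, 0 < C ∧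
      ∀ (d : ℕ) (Ω : Type*) [MeasurableSpace Ω] (P : Measure Ω) [IsProbabilityMeasure P]
        (e : ℕ → Ω → ℝ) (Z : ℕ → Ω → (Fin d → ℝ)) (X : Ω → JumpPath (Fin d → ℝ)),
      IsCompoundPoisson P lam e Z X →
      ∫⁻ ω, ENNReal.ofReal ‖Z 0 ω‖ ^ s ∂P = M →
      (∀ ε : ℝ, 0 < ε → quantNumber P (Z 0) (supDist d) s ε < ⊤) →
      ∀ r : ℝ, r₀ ≤ r →
        entropyError P X (pathDistortion (supDist d)) s
            (lam * r + (lam + 1) *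
              Real.log ((quantNumber P (Z 0) (supDist d) s (Real.exp (-r))).toNat : ℝ))
          ≤ ENNReal.ofReal (C * Real.exp (-r))) := by
  exact ⟨fun d Ω _ P _ lam e Z X h s hs γ hγ => h.one_le_liminf_log_quantError hs hγ,
    fun lam hlam => exists_entropyError_le_exp hlam⟩
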